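/- Theorem 3. Let $d\ge 1$, $L>0$ and let $m\ge 1$ be an integer. Admissible covariances. Let $C=(C_{k\ell})_{1\le k,\ell\le 2}$ be a matrix-valued stationary covariance function on $\mathbb R^d$ with $C_{12}=C_{21}$ and $C_{k\ell}(u)=K_{k\ell}(\|u\|)+r_{k\ell}(u)$, where for each $k,\ell$ there are a constant $c_{k\ell}$ (non-zero if $k=\ell$) and an exponent $\alpha_{k\ell}>0$ that is not an even integer such that: (i) $K_{k\ell}=A+B$ with $A$ even and real-analytic on $\mathbb R$, $B$ even, continuous on $[-L,L]$ and infinitely differentiable on $(0,L]$, and for every $p\ge 0$, $B^{(p)}(t)=\alpha_{k\ell}(\alpha_{k\ell}-1)\cdots(\alpha_{k\ell}-p+1)\,c_{k\ell}\,t^{\alpha_{k\ell}-p}+o(t^{\alpha_{k\ell}-p})$ as $t\downarrow 0$; (ii) $r_{k\ell}(u)=o(\|u\|^{\alpha_{k\ell}})$ as $u\to 0$, $r_{k\ell}$ is infinitely differentiable on $\mathbb R^d\setminus\{0\}$, and for every $p\ge 0$ its partial derivatives of order $p$ are $o(\|u\|^{\alpha_{k\ell}-p})$ as $u\to 0$,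 $u\ne 0$. Assume moreover $$\alpha_{11}<\alpha_{12},\qquad \alpha_{11}<\alpha_{22}+d,\qquad \alpha_{11}<4m .$$ Model. Let $(X,W)$ be a bivariate stationary Gaussian random field on $\mathbb R^d$ with such a covariance function, i.e. $X(s),W(s)$, $s\in\mathbb R^d$, are jointly Gaussian with constant means and $\mathrm{Cov}(Z_k(s+u),Z_\ell(s))=C_{k\ell}(u)$ for $Z=(X,W)$, and let $Y(s)=X(s)\beta+W(s)$ with $\beta\in\mathbb R$. Estimator. For $n\ge 1$ put $h=L/n$ and let $\mathcal G_n^{(m)}$ be the set of points $hj$, $j\in\{m,\dots,n-m\}^d$, i.e. the regular grid of $(n+1)^d$ points in $[0,L]^d$ with $m$ outer layers removed. Let $\Delta_h z(s)=h^{-2}\sum_{g=1}^d\{z(s+he_g)+z(s-he_g)-2z(s)\}$, let $\Delta_h^{(m)}$ be its $m$-th iterate, and let $$\mathrm{LAP}_n^{(m)}(X,Y)=\frac{\sum_{s\in\mathcal G_n^{(m)}}\Delta_h^{(m)}X(s)\,\Delta_h^{(m)}Y(s)}{\sum_{s\in\mathcal G_n^{(m)}}\{\Delta_h^{(m)}X(s)\}^2}.$$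 Then $\beta$ is consistently estimable from the paths of $(X,Y)$ on $[0,L]^d$: there is one sequence $T_n$ of measurable functions of the path $(X(s),Y(s))_{s\in[0,L]^d}$ such that $T_n\to\beta$ in probability under every model as above (every $\beta$ and every law of $(X,W)$ with $\alpha_{11}<4m$). Concretely, $\mathrm{LAP}_n^{(m)}(X,Y)\to\beta$ in probability as $n\to\infty$. -/

import Mathlib

open Set Filter Topology MeasureTheory ProbabilityTheory Asymptotics

/-- The falling factorial `α (α - 1) ⋯ (α - k + 1) = Γ(α + 1) / Γ(α + 1 - k)` of a real number. -/
def fallingFactorial (α : ℝ) (k : ℕ) : ℝ := ∏ i ∈ Finset.range k, (α - i)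

/-- `K = A + B` with `A` even and real-analytic and `B` even, continuous on `[-L, L]`, smooth on
`(0, L]`, and `B^{(k)}(t) = (α)_k c t^{α - k} + o(t^{α - k})` as `t ↓ 0` for every `k ≥ 0`.
The exponent `α` is positive and not an even integer. -/
structure HasPrincipalIrregularTerm (K : ℝ → ℝ) (L α c : ℝ) : Prop where
  exponent_pos : 0 < α
  exponent_not_even : ∀ k : ℕ, α ≠ 2 * (k : ℝ)
  decomposition : ∃ A B : ℝ → ℝ,
    (∀ t, K t = A t + B t) ∧
    (∀ t, A (-t) = A t) ∧ AnalyticOnNhd ℝ A univ ∧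
    (∀ t, B (-t) = B t) ∧ ContinuousOn B (Icc (-L) L) ∧ ContDiffOn ℝ ((⊤ : ℕ∞) : WithTop ℕ∞) B (Ioc 0 L) ∧
    ∀ k : ℕ, (fun t : ℝ => iteratedDeriv k B t - fallingFactorial α k * c * t ^ (α - k))
      =o[𝓝[>] 0] (fun t : ℝ => t ^ (α - k))

/-- A `2 × 2` matrix-valued function `C` on `ℝ^d` with `C₁₂ = C₂₁`, each entry of which is
`C_{kl}(u) = K_{kl}(‖u‖) + r_{kl}(u)` with `K_{kl}` having a principal irregular term of exponent
`α_{kl}` (with non-zero coefficient if `k = l`), `r_{kl}(u) = o(‖u‖^{α_{kl}})` as `u → 0`, and `r_{kl}`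
smooth away from the origin with all partial derivatives of order `p` being
`o(‖u‖^{α_{kl} - p})` as `u → 0`, `u ≠ 0`. -/
structure IsIsotropicUpToRemainder {d : ℕ}
    (C : Fin 2 → Fin 2 → EuclideanSpace ℝ (Fin d) → ℝ) (L : ℝ) (α : Fin 2 → Fin 2 → ℝ) :
    Prop where
  cross_symm : C 0 1 = C 1 0
  decomposition : ∀ k l : Fin 2, ∃ (c : ℝ) (K : ℝ → ℝ) (r : EuclideanSpace ℝ (Fin d) → ℝ),
    (k = l → c ≠ 0) ∧
    HasPrincipalIrregularTerm K L (α k l) c ∧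
    (∀ u, C k l u = K ‖u‖ + r u) ∧
    r =o[𝓝 0] (fun u => ‖u‖ ^ α k l) ∧
    ContDiffOn ℝ ((⊤ : ℕ∞) : WithTop ℕ∞) r {0}ᶜ ∧
    ∀ p : ℕ, (fun u => iteratedFDeriv ℝ p r u) =o[𝓝[≠] 0] (fun u => ‖u‖ ^ (α k l - p))

/-- `(X, W)` is a bivariate stationary Gaussian random field on `ℝ^d`: the real random variables
`X(s), W(s)`, `s ∈ ℝ^d`, are jointly Gaussian, their means do not depend on `s`, and
`C_{kl}(u) = Cov(Z_k(s + u), Z_l(s))` for every `s`, where `Z = (X, W)`. -/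
structure IsStationaryGRF {d : ℕ} {Ω : Type*} [MeasurableSpace Ω] (P : Measure Ω)
    (X W : EuclideanSpace ℝ (Fin d) → Ω → ℝ)
    (C : Fin 2 → Fin 2 → EuclideanSpace ℝ (Fin d) → ℝ) : Prop where
  measurable : ∀ k s, Measurable ((![X, W] : Fin 2 → _) k s)
  gaussian : IsGaussianProcess
    (fun z : Fin 2 × EuclideanSpace ℝ (Fin d) => (![X, W] : Fin 2 → _) z.1 z.2) P
  mean : ∀ k, ∃ μ : ℝ, ∀ s, ∫ ω, (![X, W] : Fin 2 → _) k s ω ∂P = μ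
  cov : ∀ k l s u,
    covariance ((![X, W] : Fin 2 → _) k (s + u)) ((![X, W] : Fin 2 → _) l s) P = C k l u

/-- The first order discrete Laplacian with step `h`. -/
noncomputable def discreteLaplacian {d : ℕ} (h : ℝ) (z : EuclideanSpace ℝ (Fin d) → ℝ) :
    EuclideanSpace ℝ (Fin d) → ℝ := fun s =>
  1 / h ^ 2 * ∑ g : Fin d, (z (s + h • EuclideanSpace.single g (1 : ℝ))
    + z (s - h • EuclideanSpace.single g (1 : ℝ)) - 2 * z s)

/-- Indices of the grid with `(n + 1)^d` points after `m` outer layers have been removed. -/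
def gridInterior (d n m : ℕ) : Finset (Fin d → ℕ) :=
  Fintype.piFinset fun _ => Finset.Icc m (n - m)

/-- The point of index `j` of the regular grid with step `h`. -/
noncomputable def gridPoint {d : ℕ} (h : ℝ) (j : Fin d → ℕ) : EuclideanSpace ℝ (Fin d) :=
  WithLp.toLp 2 fun g => h * (j g : ℝ)

/-- The ordinary least squares coefficient in the regression of the `m`-th order discrete Laplacians
of `z₂` on those of `z₁` over the regular grid of `(n + 1)^d` points in `[0, L]^d`. For `s` in the
`m`-th interior, the `m`-th Laplacian at `s` involves only values at points of that grid. -/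
noncomputable def lapEstimator {d : ℕ} (L : ℝ) (m n : ℕ)
    (z₁ z₂ : EuclideanSpace ℝ (Fin d) → ℝ) : ℝ :=
  (∑ j ∈ gridInterior d n m,
      (discreteLaplacian (L / n))^[m] z₁ (gridPoint (L / n) j)
        * (discreteLaplacian (L / n))^[m] z₂ (gridPoint (L / n) j))
    / ∑ j ∈ gridInterior d n m, ((discreteLaplacian (L / n))^[m] z₁ (gridPoint (L / n) j)) ^ 2

/-- The cube `[0, L]^d`. -/
def cube (d : ℕ) (L : ℝ) : Set (EuclideanSpace ℝ (Fin d)) := {s | ∀ g, s g ∈ Icc 0 L}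

/-- All pairs of a slope `β` and a law of the paths `s ↦ (X(s), Y(s))` on `[0, L]^d`, where
`Y = X β + W` and `(X, W)` is any stationary Gaussian random field whose covariance function is
isotropic up to a remainder, with exponents such that `α₁₁ < α₁₂`, `α₁₁ < α₂₂ + d` and
`α₁₁ < 4 m`. -/
def slopeModels (d : ℕ) (L : ℝ) (m : ℕ) : Set (ℝ × Measure (cube d L → ℝ × ℝ)) :=
  {q | ∃ (Ω : Type) (_ : MeasurableSpace Ω) (P : Measure Ω)
      (X W : EuclideanSpace ℝ (Fin d) → Ω → ℝ)
      (C : Fin 2 → Fin 2 → EuclideanSpace ℝ (Fin d) → ℝ) (α : Fin 2 → Fin 2 → ℝ),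
    IsProbabilityMeasure P ∧ IsStationaryGRF P X W C ∧ IsIsotropicUpToRemainder C L α ∧
    α 0 0 < α 0 1 ∧ α 0 0 < α 1 1 + d ∧ α 0 0 < 4 * m ∧
    q.2 = P.map (fun ω (s : cube d L) => (X s ω, X s ω * q.1 + W s ω))}

/-- The real parameter is consistently estimable over a set of pairs (parameter, law of the
observation): one sequence of estimators, i.e. measurable functions of the observation, converges in
probability to the parameter under every pair of the set. -/
def ConsistentlyEstimable {S : Type*} [MeasurableSpace S] (M : Set (ℝ × Measure S)) : Prop :=
  ∃ T : ℕ → S → ℝ, (∀ n, Measurable (T n)) ∧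
    ∀ q ∈ M, TendstoInMeasure q.2 T atTop (fun _ => q.1)

/-! Write ξ and η for the `m`-th discrete Laplacians of `X` and `W`. By linearity the numerator of
the estimator is β Σξ² + Σξη, so its error is the ratio Σξη / Σξ². Put ρ = 4m − `α 0 0` > 0 and
multiply both sums by h^ρ / (number of grid points). It then suffices that the weighted Σξ² tends in
probability to some κ > 0 and the weighted Σξη to 0. Chebyshev's inequality reduces each claim to a
mean and a variance.

Means. Differencing both arguments of a stationary covariance gives cov(ξ, η) = Δ^{2m} C. Near lag 0
the smooth part of C contributes a bounded quantity, and the irregular part of exponent α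
contributes O((h + ‖u‖)^{α − 4m}): derivatives control it when the stencil stays away from the
origin, mere size when it does not. After rescaling, the covariance of ξ at lag hu tends to c
Δ₁^{2m}‖·‖^α (u). A covariance is at most the variance, so κ dominates the absolute value of this
limit for every u. The limit is not identically zero: ‖·‖^α is not analytic at 0 for α not an even
integer, and along an axis the outermost translate of this singularity is not cancelled by the
others. Hence κ > 0. The mean of ξη is of lower order because `α 0 0 < α 0 1`.

Variances. By Isserlis' formula cov(ξη(s), ξη(t)) is a sum of two products of such covariances. The
weighted double sum of (h + ‖s − t‖)^{−σ} over the grid vanishes as soon as σ < 2ρ + d, and for the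
product of the two marginal covariances this is the condition `α 0 0 < α 1 1 + d`. Nothing is known
about large lags; this is circumvented by cutting the cube into a fixed number of small blocks,
since the variance of a sum of N terms is at most N times the sum of their variances. -/

/-! ### Discrete Laplacians: derivative bounds, locality, stencils. -/

section FiniteDifferences

/-- Taking a first difference lowers by one the order of the derivative that has to be bounded. -/
theorem norm_iteratedFDeriv_difference_le {E : Type*} [NormedAddCommGroup E] [NormedSpace ℝ E]
    {f : E → ℝ} {u : E} {R B : ℝ} {p : ℕ}
    (hf : ∀ x ∈ Metric.ball u R, ContDiffAt ℝ ((⊤ : ℕ∞) : WithTop ℕ∞) f x ∧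
      ‖iteratedFDeriv ℝ (p + 1) f x‖ ≤ B) (v : E) :
    ∀ x ∈ Metric.ball u (R - ‖v‖),
      ContDiffAt ℝ ((⊤ : ℕ∞) : WithTop ℕ∞) (fun y => f (y + v) - f y) x ∧
      ‖iteratedFDeriv ℝ p (fun y => f (y + v) - f y) x‖ ≤ B * ‖v‖ := by
  intro x hx
  rw [Metric.mem_ball, dist_eq_norm] at hx
  have hx0 : x ∈ Metric.ball u R := by
    rw [Metric.mem_ball, dist_eq_norm]; linarith [norm_nonneg v]
  have hx1 : x + v ∈ Metric.ball u R := by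
    rw [Metric.mem_ball, dist_eq_norm]
    calc ‖x + v - u‖ = ‖(x - u) + v‖ := by congr 1; abel
      _ ≤ ‖x - u‖ + ‖v‖ := norm_add_le _ _
      _ < R := by linarith
  have h0 := (hf x hx0).1
  have h1 : ContDiffAt ℝ ((⊤ : ℕ∞) : WithTop ℕ∞) (fun y => f (y + v)) x :=
    ContDiffAt.comp x (f := fun y => y + v) (hf _ hx1).1 (contDiffAt_id.add contDiffAt_const)
  refine ⟨h1.sub h0, ?_⟩
  have hle : (p : WithTop ℕ∞) ≤ ((⊤ : ℕ∞) : WithTop ℕ∞) := by exact_mod_cast le_top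
  have : iteratedFDeriv ℝ p (fun y => f (y + v) - f y) x =
      iteratedFDeriv ℝ p f (x + v) - iteratedFDeriv ℝ p f x := by
    have := iteratedFDeriv_sub_apply (𝕜 := ℝ) (h1.of_le hle) (h0.of_le hle)
    rw [iteratedFDeriv_comp_add_right] at this
    exact this
  rw [this]
  have key := Convex.norm_image_sub_le_of_norm_fderiv_le (𝕜 := ℝ) (f := iteratedFDeriv ℝ p f)
    (s := Metric.ball u R) (C := B)
    (fun y hy => (hf y hy).1.differentiableAt_iteratedFDeriv (by exact_mod_cast WithTop.coe_lt_top p))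
    (fun y hy => by rw [norm_fderiv_iteratedFDeriv]; exact (hf y hy).2)
    (convex_ball u R) hx0 hx1
  simpa using key

variable {d : ℕ}

theorem discreteLaplacian_add (h : ℝ) (f g : EuclideanSpace ℝ (Fin d) → ℝ) :
    discreteLaplacian h (fun s => f s + g s) =
      fun s => discreteLaplacian h f s + discreteLaplacian h g s := by
  funext s
  simp only [discreteLaplacian, ← mul_add, ← Finset.sum_add_distrib]
  congr 1
  refine Finset.sum_congr rfl fun g _ => ?_
  ring

theorem iterate_discreteLaplacian_add (h : ℝ) (M : ℕ) (f g : EuclideanSpace ℝ (Fin d) → ℝ) :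
    (discreteLaplacian h)^[M] (fun s => f s + g s) =
      fun s => (discreteLaplacian h)^[M] f s + (discreteLaplacian h)^[M] g s := by
  induction M generalizing f g with
  | zero => rfl
  | succ M ih => simp only [Function.iterate_succ_apply, discreteLaplacian_add, ih]

theorem discreteLaplacian_mul_const (h c : ℝ) (f : EuclideanSpace ℝ (Fin d) → ℝ) :
    discreteLaplacian h (fun s => f s * c) = fun s => discreteLaplacian h f s * c := by
  funext s
  simp only [discreteLaplacian, mul_assoc, Finset.sum_mul]
  congr 1
  refine Finset.sum_congr rfl fun g _ => ?_
  ring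

theorem iterate_discreteLaplacian_mul_const (h c : ℝ) (M : ℕ)
    (f : EuclideanSpace ℝ (Fin d) → ℝ) :
    (discreteLaplacian h)^[M] (fun s => f s * c) =
      fun s => (discreteLaplacian h)^[M] f s * c := by
  induction M generalizing f with
  | zero => rfl
  | succ M ih => simp only [Function.iterate_succ_apply, discreteLaplacian_mul_const, ih]

theorem discreteLaplacian_neg_step (h : ℝ) :
    discreteLaplacian (d := d) (-h) = discreteLaplacian h := by
  funext z s
  simp only [discreteLaplacian, neg_sq, neg_smul, sub_neg_eq_add, ← sub_eq_add_neg]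
  congr 1
  refine Finset.sum_congr rfl fun g _ => ?_
  ring

theorem norm_smul_single (h : ℝ) (g : Fin d) :
    ‖h • (EuclideanSpace.single g (1 : ℝ) : EuclideanSpace ℝ (Fin d))‖ = |h| := by
  rw [norm_smul, PiLp.norm_single]; simp

/-- The iterated discrete Laplacian only involves values at distance at most `M h`. -/
theorem iterate_discreteLaplacian_congr {h : ℝ} {M : ℕ} {f g : EuclideanSpace ℝ (Fin d) → ℝ}
    {s : EuclideanSpace ℝ (Fin d)}
    (hfg : ∀ x, (∀ i, |x i - s i| ≤ M * |h|) → f x = g x) :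
    (discreteLaplacian h)^[M] f s = (discreteLaplacian h)^[M] g s := by
  induction M generalizing f g with
  | zero => exact hfg s (by simp)
  | succ M ih =>
    rw [Function.iterate_succ_apply, Function.iterate_succ_apply]
    refine ih fun x hx => ?_
    have key : ∀ c : ℝ, |c| ≤ |h| → ∀ k : Fin d,
        f (x + c • EuclideanSpace.single k (1 : ℝ)) =
          g (x + c • EuclideanSpace.single k (1 : ℝ)) := by
      intro c hc k
      refine hfg _ fun i => ?_
      have h1 : |(x + c • (EuclideanSpace.single k (1 : ℝ) : EuclideanSpace ℝ (Fin d))) i - x i|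
          ≤ |h| := by
        simp only [PiLp.add_apply, PiLp.smul_apply, PiLp.single_apply, smul_eq_mul,
          add_sub_cancel_left]
        split_ifs
        · simpa using hc
        · simp
      calc _ = |((x + c • (EuclideanSpace.single k (1 : ℝ) : EuclideanSpace ℝ (Fin d))) i - x i)
              + (x i - s i)| := by congr 1; ring
        _ ≤ |h| + M * |h| := (abs_add_le _ _).trans (add_le_add h1 (hx i))
        _ = _ := by push_cast; ring
    simp only [discreteLaplacian]
    congr 1
    refine Finset.sum_congr rfl fun k _ => ?_
    have h0 := key 0 (by simp) k
    have h1 := key h le_rfl k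
    have h2 := key (-h) (by simp) k
    simp only [zero_smul, add_zero, neg_smul, ← sub_eq_add_neg] at h0 h1 h2
    rw [h0, h1, h2]

/-- Each coordinate term is minus a composition of first differences with steps h e_g and −h e_g.
Two extra derivatives yield a factor h², which cancels h⁻², at the cost of shrinking the ball by 2h.
-/
theorem norm_iteratedFDeriv_discreteLaplacian_le
    {f : EuclideanSpace ℝ (Fin d) → ℝ} {u : EuclideanSpace ℝ (Fin d)} {R B h : ℝ} {p : ℕ}
    (hh : 0 < h)
    (hf : ∀ x ∈ Metric.ball u R, ContDiffAt ℝ ((⊤ : ℕ∞) : WithTop ℕ∞) f x ∧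
      ‖iteratedFDeriv ℝ (p + 2) f x‖ ≤ B) :
    ∀ x ∈ Metric.ball u (R - 2 * h),
      ContDiffAt ℝ ((⊤ : ℕ∞) : WithTop ℕ∞) (discreteLaplacian h f) x ∧
      ‖iteratedFDeriv ℝ p (discreteLaplacian h f) x‖ ≤ d * B := by
  intro x hx
  set F : Fin d → EuclideanSpace ℝ (Fin d) → ℝ := fun g s =>
    (fun y => f (y + h • EuclideanSpace.single g (1 : ℝ)) - f y)
      (s + (-h) • EuclideanSpace.single g (1 : ℝ)) -
    (fun y => f (y + h • EuclideanSpace.single g (1 : ℝ)) - f y) s with hF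
  have hL : discreteLaplacian h f = (-(1 / h ^ 2) : ℝ) • fun s => ∑ g, F g s := by
    funext s
    simp only [discreteLaplacian, hF, Pi.smul_apply, smul_eq_mul, neg_mul, ← mul_neg,
      ← Finset.sum_neg_distrib]
    congr 1
    refine Finset.sum_congr rfl fun g _ => ?_
    simp only [neg_smul, ← sub_eq_add_neg, sub_add_cancel]
    ring
  have hFg : ∀ g, ContDiffAt ℝ ((⊤ : ℕ∞) : WithTop ℕ∞) (F g) x ∧
      ‖iteratedFDeriv ℝ p (F g) x‖ ≤ B * h ^ 2 := by
    intro g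
    have h1 := norm_iteratedFDeriv_difference_le hf
      (h • (EuclideanSpace.single g (1 : ℝ) : EuclideanSpace ℝ (Fin d)))
    have h2 := norm_iteratedFDeriv_difference_le h1
      ((-h) • (EuclideanSpace.single g (1 : ℝ) : EuclideanSpace ℝ (Fin d))) x (by
        rw [norm_smul_single, norm_smul_single, abs_neg, abs_of_pos hh]
        rwa [sub_sub, ← two_mul])
    rw [norm_smul_single, norm_smul_single, abs_neg, abs_of_pos hh] at h2
    refine ⟨h2.1, h2.2.trans (le_of_eq (by ring))⟩
  have hle : (p : WithTop ℕ∞) ≤ ((⊤ : ℕ∞) : WithTop ℕ∞) := by exact_mod_cast le_top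
  have hsum : ContDiffAt ℝ ((⊤ : ℕ∞) : WithTop ℕ∞) (fun s => ∑ g, F g s) x :=
    ContDiffAt.sum fun g _ => (hFg g).1
  rw [hL]
  refine ⟨contDiffAt_const.smul hsum, ?_⟩
  rw [iteratedFDeriv_const_smul_apply (hsum.of_le hle),
    iteratedFDeriv_fun_sum_apply fun g _ => (hFg g).1.of_le hle, norm_smul]
  calc ‖(-(1 / h ^ 2) : ℝ)‖ * ‖∑ g, iteratedFDeriv ℝ p (F g) x‖
      ≤ (1 / h ^ 2) * ∑ g : Fin d, B * h ^ 2 := by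
        rw [norm_neg, Real.norm_of_nonneg (by positivity)]
        gcongr
        exact (norm_sum_le _ _).trans (Finset.sum_le_sum fun g _ => (hFg g).2)
    _ = d * B := by
        rw [Finset.sum_const, Finset.card_univ, Fintype.card_fin, nsmul_eq_mul]
        field_simp

/-- The iterated discrete Laplacian of a smooth function is bounded by its derivatives of order
`2 M`. -/
theorem abs_iterate_discreteLaplacian_le
    {f : EuclideanSpace ℝ (Fin d) → ℝ} {u : EuclideanSpace ℝ (Fin d)} {R B h : ℝ} {M : ℕ}
    (hh : 0 < h) (hR : 2 * M * h < R)
    (hf : ∀ x ∈ Metric.ball u R, ContDiffAt ℝ ((⊤ : ℕ∞) : WithTop ℕ∞) f x ∧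
      ‖iteratedFDeriv ℝ (2 * M) f x‖ ≤ B) :
    |(discreteLaplacian h)^[M] f u| ≤ d ^ M * B := by
  induction M generalizing f R B with
  | zero =>
    have := (hf u (Metric.mem_ball_self (by simpa using hR))).2
    simpa using this
  | succ M ih =>
    rw [Function.iterate_succ_apply]
    refine (ih (R := R - 2 * h) (B := d * B) ?_
      (norm_iteratedFDeriv_discreteLaplacian_le hh fun x hx => ?_)).trans (le_of_eq (by ring))
    · push_cast at hR; linarith
    · exact ⟨(hf x hx).1, (hf x hx).2⟩

/-- The iterated discrete Laplacian is a finite linear combination of values. -/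
theorem exists_stencil (d M : ℕ) : ∃ (N : ℕ) (w : Fin N → ℝ) (k : Fin N → EuclideanSpace ℝ (Fin d)),
    (∀ i, ‖k i‖ ≤ M) ∧ ∀ (h : ℝ) (z : EuclideanSpace ℝ (Fin d) → ℝ) (s),
      (discreteLaplacian h)^[M] z s = (1 / h ^ 2) ^ M * ∑ i, w i * z (s + h • k i) := by
  induction M with
  | zero => exact ⟨1, fun _ => 1, fun _ => 0, by simp, by simp⟩
  | succ M ih =>
    obtain ⟨N, w, k, hk, hz⟩ := ih
    let e : Fin d × Fin 3 × Fin N ≃ Fin (Fintype.card (Fin d × Fin 3 × Fin N)) :=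
      Fintype.equivFin _
    let w' : Fin d × Fin 3 × Fin N → ℝ := fun p => (![1, 1, -2] p.2.1 : ℝ) * w p.2.2
    let k' : Fin d × Fin 3 × Fin N → EuclideanSpace ℝ (Fin d) := fun p =>
      k p.2.2 + (![1, -1, 0] p.2.1 : ℝ) • EuclideanSpace.single p.1 (1 : ℝ)
    refine ⟨_, w' ∘ e.symm, k' ∘ e.symm, fun i => ?_, fun h z s => ?_⟩
    · simp only [Function.comp, k']
      refine (norm_add_le _ _).trans ?_
      rw [norm_smul_single]
      push_cast
      refine add_le_add (hk _) ?_
      generalize (e.symm i).2.1 = j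
      fin_cases j <;> simp
    · rw [Function.iterate_succ_apply', ← e.sum_comp]
      simp only [Function.comp, Equiv.symm_apply_apply, w', k']
      rw [Fintype.sum_prod_type]
      simp only [Fintype.sum_prod_type, Fin.sum_univ_three]
      simp only [discreteLaplacian, hz, pow_succ, Finset.mul_sum]
      refine Finset.sum_congr rfl fun g _ => ?_
      simp only [Matrix.cons_val, ← Finset.sum_add_distrib, Finset.mul_sum, ← Finset.sum_sub_distrib]
      refine Finset.sum_congr rfl fun i _ => ?_
      have e1 : s + h • (EuclideanSpace.single g (1 : ℝ) : EuclideanSpace ℝ (Fin d)) + h • k i =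
        s + h • (k i + (1 : ℝ) • EuclideanSpace.single g (1 : ℝ)) := by module
      have e2 : s - h • (EuclideanSpace.single g (1 : ℝ) : EuclideanSpace ℝ (Fin d)) + h • k i =
        s + h • (k i + (-1 : ℝ) • EuclideanSpace.single g (1 : ℝ)) := by module
      have e3 : s + h • k i =
        s + h • (k i + (0 : ℝ) • (EuclideanSpace.single g (1 : ℝ) : EuclideanSpace ℝ (Fin d))) := by
        module
      rw [e1, e2, e3]
      ring

end FiniteDifferences

/-! ### Smoothness and derivative bounds of radial functions. -/

section RadialFunctions

/-- An even analytic function is an analytic function of the square near the origin. -/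
theorem AnalyticAt.exists_eventually_eq_comp_sq {A : ℝ → ℝ} (hA : AnalyticAt ℝ A 0)
    (heven : ∀ t, A (-t) = A t) :
    ∃ F : ℝ → ℝ, AnalyticAt ℝ F 0 ∧ ∀ᶠ t in 𝓝 0, A t = F (t ^ 2) := by
  obtain ⟨p, r, hp⟩ := hA
  obtain ⟨ρ, hρ0, hρr⟩ := ENNReal.lt_iff_exists_nnreal_btwn.1 hp.r_pos
  have hρ0' : 0 < ρ := by exact_mod_cast hρ0
  set q : FormalMultilinearSeries ℝ ℝ ℝ :=
    FormalMultilinearSeries.ofScalars ℝ fun i => p.coeff (2 * i) with hq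
  obtain ⟨C, -, hC⟩ := p.norm_mul_pow_le_of_lt_radius (hρr.trans_le hp.r_le)
  have hrad : ((ρ ^ 2 : NNReal) : ENNReal) ≤ q.radius := by
    refine q.le_radius_of_bound C fun n => ?_
    have := hC (2 * n)
    rw [FormalMultilinearSeries.ofScalars_norm]
    rw [pow_mul] at this
    rw [← FormalMultilinearSeries.norm_apply_eq_norm_coef] at *
    simpa using this
  have hpos : 0 < q.radius := lt_of_lt_of_le (by exact_mod_cast pow_pos hρ0' 2) hrad
  have hqball := q.hasFPowerSeriesOnBall hpos
  refine ⟨q.sum, hqball.analyticAt, ?_⟩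
  filter_upwards [Metric.eball_mem_nhds (0 : ℝ) hρ0] with t ht
  have key : ∀ s ∈ Metric.eball (0 : ℝ) ρ, HasSum (fun n => s ^ n * p.coeff n) (A s) := by
    intro s hs
    have := hp.hasSum (y := s) (Metric.eball_subset_eball hρr.le hs)
    simpa using this
  have h1 := key t ht
  have h2 := key (-t) (by simpa using ht)
  rw [heven] at h2
  -- Averaging the expansions at t and −t removes the odd coefficients, leaving a power series in
  -- t².
  have h3 := (h1.add h2).div_const 2
  have h4 : HasSum (fun i : ℕ => (t ^ 2) ^ i * p.coeff (2 * i)) (A t) := by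
    have inj : Function.Injective fun i : ℕ => 2 * i := fun a b h => by simpa using h
    have := (inj.hasSum_iff (f := fun n => (t ^ n * p.coeff n + (-t) ^ n * p.coeff n) / 2)
      (a := (A t + A t) / 2) ?_).2 h3
    · convert! this using 1
      · funext i
        simp [pow_mul]
      · ring
    · intro n hn
      have hodd : Odd n := by
        rw [← Nat.not_even_iff_odd]
        rintro ⟨k, rfl⟩
        exact hn ⟨k, by simp; ring⟩
      rw [hodd.neg_pow]; ring
  have h5 : q.sum (t ^ 2) = ∑' i : ℕ, (t ^ 2) ^ i * p.coeff (2 * i) := by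
    rw [FormalMultilinearSeries.sum]
    refine tsum_congr fun i => ?_
    simp [hq, FormalMultilinearSeries.coeff_ofScalars]
  rw [h5, h4.tsum_eq]

variable {E : Type*} [NormedAddCommGroup E] [InnerProductSpace ℝ E]

/-- An even analytic function of the norm is smooth near the origin. -/
theorem exists_norm_iteratedFDeriv_comp_norm_le_of_even {A : ℝ → ℝ} (hA : AnalyticAt ℝ A 0)
    (heven : ∀ t, A (-t) = A t) (p : ℕ) :
    ∃ δ > 0, ∃ B : ℝ, ∀ x ∈ Metric.ball (0 : E) δ,
      ContDiffAt ℝ ((⊤ : ℕ∞) : WithTop ℕ∞) (fun u => A ‖u‖) x ∧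
      ‖iteratedFDeriv ℝ p (fun u : E => A ‖u‖) x‖ ≤ B := by
  obtain ⟨F, hF, hAF⟩ := hA.exists_eventually_eq_comp_sq heven
  obtain ⟨s, hs, hFs⟩ := hF.eventually_analyticAt.exists_mem
  have hcont : ContDiff ℝ ((⊤ : ℕ∞) : WithTop ℕ∞) (fun u : E => ‖u‖ ^ 2) := contDiff_norm_sq ℝ
  have hev1 : ∀ᶠ x in 𝓝 (0 : E), ‖x‖ ^ 2 ∈ s := by
    have : Tendsto (fun u : E => ‖u‖ ^ 2) (𝓝 0) (𝓝 0) := by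
      simpa using hcont.continuous.tendsto 0
    exact this hs
  have hev2 : ∀ᶠ x in 𝓝 (0 : E), (fun u : E => A ‖u‖) =ᶠ[𝓝 x] fun u => F (‖u‖ ^ 2) := by
    have : Tendsto (fun u : E => ‖u‖) (𝓝 0) (𝓝 0) := by
      simpa using continuous_norm.tendsto (0 : E)
    exact (this.eventually hAF).eventually_nhds
  have hev3 : ∀ᶠ x in 𝓝 (0 : E),
      ContDiffAt ℝ ((⊤ : ℕ∞) : WithTop ℕ∞) (fun u => A ‖u‖) x := by
    filter_upwards [hev1, hev2] with x h1 h2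
    exact ContDiffAt.congr_of_eventuallyEq
      (ContDiffAt.comp x (f := fun u : E => ‖u‖ ^ 2) (hFs _ h1).contDiffAt hcont.contDiffAt) h2
  have hle : (p : WithTop ℕ∞) ≤ ((⊤ : ℕ∞) : WithTop ℕ∞) := by exact_mod_cast le_top
  have hc := (hev3.self_of_nhds.continuousAt_iteratedFDeriv hle).norm
  have hev4 := hc.eventually (gt_mem_nhds (lt_add_one _))
  obtain ⟨δ, hδ, hball⟩ := Metric.eventually_nhds_iff_ball.1 (hev3.and hev4)
  exact ⟨δ, hδ, _, fun x hx => ⟨(hball x hx).1, (hball x hx).2.le⟩⟩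

theorem norm_iteratedFDeriv_comp_smul_le {G : Type*} [NormedAddCommGroup G] [NormedSpace ℝ G]
    (N : E → G) {c : ℝ} (hc : 0 < c) (i : ℕ) (u : E) :
    ‖iteratedFDeriv ℝ i (fun x => N (c • x)) u‖ ≤ c ^ i * ‖iteratedFDeriv ℝ i N (c • u)‖ := by
  set g : E ≃L[ℝ] E := ContinuousLinearEquiv.smulLeft (Units.mk0 c hc.ne') with hg
  have h1 := g.iteratedFDerivWithin_comp_right (s := univ) N uniqueDiffOn_univ (x := u)
    (mem_univ _) i
  rw [preimage_univ, iteratedFDerivWithin_univ, iteratedFDerivWithin_univ] at h1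
  have h2 : (N ∘ g) = fun x => N (c • x) := rfl
  rw [← h2, h1]
  refine (ContinuousMultilinearMap.norm_compContinuousLinearMap_le _ _).trans ?_
  rw [mul_comm, Finset.prod_const, Finset.card_univ, Fintype.card_fin]
  have h3 : ‖(g : E →L[ℝ] E)‖ ≤ c := by
    refine ContinuousLinearMap.opNorm_le_bound _ hc.le fun x => ?_
    have : (g : E →L[ℝ] E) x = c • x := rfl
    rw [this, norm_smul, Real.norm_of_nonneg hc.le]
  exact mul_le_mul_of_nonneg_right (pow_le_pow_left₀ (norm_nonneg _) h3 i) (norm_nonneg _)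

theorem iteratedDeriv_comp_mul_left_field (B : ℝ → ℝ) (c : ℝ) (k : ℕ) :
    iteratedDeriv k (fun s => B (c * s)) = fun s => c ^ k * iteratedDeriv k B (c * s) := by
  induction k with
  | zero => simp
  | succ k ih =>
    funext s
    rw [iteratedDeriv_succ, ih, iteratedDeriv_succ, deriv_const_mul_field, deriv_comp_mul_left,
      smul_eq_mul]
    ring

theorem exists_norm_iteratedFDeriv_norm_le_on_sphere [FiniteDimensional ℝ E] (p : ℕ) :
    ∃ D : ℝ, 1 ≤ D ∧ ∀ i ≤ p, ∀ x : E, ‖x‖ = 1 →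
      ‖iteratedFDeriv ℝ i (fun y : E => ‖y‖) x‖ ≤ D := by
  have h : ∀ i : ℕ, ∃ D : ℝ, ∀ x : E, ‖x‖ = 1 → ‖iteratedFDeriv ℝ i (fun y : E => ‖y‖) x‖ ≤ D := by
    intro i
    have hc : ContinuousOn (iteratedFDeriv ℝ i (fun y : E => ‖y‖)) (Metric.sphere 0 1) := by
      intro x hx
      have hx0 : x ≠ 0 := by
        rintro rfl; simp at hx
      exact (ContDiffAt.continuousAt_iteratedFDeriv (contDiffAt_norm ℝ hx0 (n := (i : WithTop ℕ∞)))
        le_rfl).continuousWithinAt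
    obtain ⟨D, hD⟩ := (isCompact_sphere (0 : E) 1).exists_bound_of_continuousOn hc
    exact ⟨D, fun x hx => hD x (by simpa using hx)⟩
  choose D hD using h
  refine ⟨1 + ∑ i ∈ Finset.range (p + 1), |D i|, le_add_of_nonneg_right (by positivity),
    fun i hi x hx => ?_⟩
  have := Finset.single_le_sum (f := fun i => |D i|) (fun _ _ => abs_nonneg _)
    (Finset.mem_range.2 (Nat.lt_succ_of_le hi))
  linarith [hD i x hx, le_abs_self (D i)]

/-- Power bounds on the derivatives of a function of one variable near `0` carry over to the
associated radial function. -/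
theorem exists_norm_iteratedFDeriv_comp_norm_le [FiniteDimensional ℝ E] {B : ℝ → ℝ} {L α C δ : ℝ}
    (hδL : δ < L) (hB : ContDiffOn ℝ ((⊤ : ℕ∞) : WithTop ℕ∞) B (Ioc 0 L)) (p : ℕ)
    (hC : ∀ i ≤ p, ∀ t, 0 < t → t < δ → |iteratedDeriv i B t| ≤ C * t ^ (α - i)) :
    ∃ C' : ℝ, ∀ x : E, 0 < ‖x‖ → ‖x‖ < δ →
      ContDiffAt ℝ ((⊤ : ℕ∞) : WithTop ℕ∞) (fun u => B ‖u‖) x ∧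
      ‖iteratedFDeriv ℝ p (fun u : E => B ‖u‖) x‖ ≤ C' * ‖x‖ ^ (α - p) := by
  obtain ⟨D, hD1, hD⟩ := exists_norm_iteratedFDeriv_norm_le_on_sphere (E := E) p
  refine ⟨p.factorial * C * D ^ p, fun x hx hxδ => ?_⟩
  have hx0 : x ≠ 0 := norm_pos_iff.1 hx
  set t := ‖x‖ with ht
  have hBt : ContDiffOn ℝ ((⊤ : ℕ∞) : WithTop ℕ∞) B (Ioo 0 L) := hB.mono Ioo_subset_Ioc_self
  have hBx : ContDiffAt ℝ ((⊤ : ℕ∞) : WithTop ℕ∞) B ‖x‖ :=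
    hBt.contDiffAt (Ioo_mem_nhds hx (hxδ.trans hδL))
  refine ⟨ContDiffAt.comp x (f := fun u : E => ‖u‖) hBx (contDiffAt_norm ℝ hx0), ?_⟩
  -- Rescaling by t = ‖x‖: B(‖·‖) is g ∘ f with f(x) = 1. The i-th derivatives of g at 1 are O(t^α)
  -- and those of f at x are at most (D/t)^i, so the composition bound for iterated derivatives
  -- gives exactly t^(α − p).
  set g : ℝ → ℝ := fun s => B (t * s) with hg
  set f : E → ℝ := fun y => ‖t⁻¹ • y‖ with hf
  set U : Set ℝ := Ioo 0 (L / t) with hU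
  set S : Set E := {y | 0 < ‖y‖ ∧ ‖y‖ < L} with hS
  have hSo : IsOpen S :=
    (isOpen_lt continuous_const continuous_norm).inter (isOpen_lt continuous_norm continuous_const)
  have hfy : ∀ y, f y = t⁻¹ * ‖y‖ := fun y => by
    simp only [hf, norm_smul, norm_inv]
    rw [Real.norm_of_nonneg hx.le]
  have hgf : (fun u : E => B ‖u‖) = g ∘ f := by
    funext y
    simp only [hg, Function.comp, hfy]
    rw [mul_inv_cancel_left₀ hx.ne']
  have hxS : x ∈ S := ⟨hx, hxδ.trans hδL⟩
  have hgU : ContDiffOn ℝ ((⊤ : ℕ∞) : WithTop ℕ∞) g U := by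
    refine hBt.comp (contDiff_const.mul contDiff_id).contDiffOn fun s hs => ?_
    refine ⟨mul_pos hx hs.1, ?_⟩
    have := (lt_div_iff₀' hx).1 hs.2
    exact this
  have hfS : ContDiffOn ℝ ((⊤ : ℕ∞) : WithTop ℕ∞) f S := by
    intro y hy
    have hy0 : y ≠ 0 := norm_pos_iff.1 hy.1
    have : ContDiffAt ℝ ((⊤ : ℕ∞) : WithTop ℕ∞) (fun y : E => t⁻¹ * ‖y‖) y :=
      contDiffAt_const.mul (contDiffAt_norm ℝ hy0)
    rw [show f = fun y : E => t⁻¹ * ‖y‖ from funext hfy]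
    exact this.contDiffWithinAt
  have hmaps : MapsTo f S U := by
    intro y hy
    rw [hfy]
    exact ⟨mul_pos (inv_pos.2 hx) hy.1, by
      rw [lt_div_iff₀ hx, mul_right_comm, inv_mul_cancel₀ hx.ne', one_mul]; exact hy.2⟩
  have hle : (p : WithTop ℕ∞) ≤ ((⊤ : ℕ∞) : WithTop ℕ∞) := by exact_mod_cast le_top
  have hfx : f x = 1 := by rw [hfy, ← ht, inv_mul_cancel₀ hx.ne']
  have key := norm_iteratedFDerivWithin_comp_le (n := p) (C := C * t ^ α) (D := D / t) hgU hfS hle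
    isOpen_Ioo.uniqueDiffOn hSo.uniqueDiffOn hmaps hxS (fun i hi => ?_) (fun i hi1 hi => ?_)
  · rw [iteratedFDerivWithin_of_isOpen p hSo hxS, ← hgf] at key
    refine key.trans (le_of_eq ?_)
    rw [Real.rpow_sub hx, Real.rpow_natCast, div_pow]
    ring
  · rw [iteratedFDerivWithin_of_isOpen i isOpen_Ioo (hmaps hxS), norm_iteratedFDeriv_eq_norm_iteratedDeriv,
      hfx, hg, iteratedDeriv_comp_mul_left_field, Real.norm_eq_abs, abs_mul,
      abs_of_pos (pow_pos hx i), mul_one]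
    refine (mul_le_mul_of_nonneg_left (hC i hi t hx hxδ) (pow_pos hx i).le).trans (le_of_eq ?_)
    rw [Real.rpow_sub hx, Real.rpow_natCast]
    field_simp
  · rw [iteratedFDerivWithin_of_isOpen i hSo hxS]
    refine (norm_iteratedFDeriv_comp_smul_le (fun y : E => ‖y‖) (inv_pos.2 hx) i x).trans ?_
    rw [div_pow, inv_pow, div_eq_inv_mul]
    refine mul_le_mul_of_nonneg_left ?_ (by positivity)
    refine (hD i hi _ ?_).trans (le_self_pow₀ hD1 (by omega))
    rw [← hfx]

end RadialFunctions

/-! ### Laplacians of a covariance near lag zero: bounds and scaling limit. -/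

section LocalCovariance

/-- `f = S + R` near the origin, with `S` smooth, and with `R(u) ∼ c ‖u‖^α` having derivatives of
order `p` bounded by `‖u‖^{α - p}`. -/
structure HasLocalExpansion {E : Type*} [NormedAddCommGroup E] [NormedSpace ℝ E] (f : E → ℝ)
    (α c : ℝ) (p : ℕ) : Prop where
  exists_decomposition : ∃ S R : E → ℝ, ∃ δ > 0, ∃ B : ℝ, (∀ u, f u = S u + R u) ∧
    (∀ x ∈ Metric.ball (0 : E) δ, ContDiffAt ℝ ((⊤ : ℕ∞) : WithTop ℕ∞) S x ∧
      ‖iteratedFDeriv ℝ p S x‖ ≤ B) ∧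
    (∀ x : E, 0 < ‖x‖ → ‖x‖ < δ → ContDiffAt ℝ ((⊤ : ℕ∞) : WithTop ℕ∞) R x ∧
      ‖iteratedFDeriv ℝ p R x‖ ≤ B * ‖x‖ ^ (α - p)) ∧
    (fun u => R u - c * ‖u‖ ^ α) =o[𝓝 0] fun u => ‖u‖ ^ α

/-- The one-sided expansion does not see the value at 0; continuity forces it to be 0. This is
needed because the radial expansion is stated on a full neighbourhood of the origin, centre
included. -/
theorem HasPrincipalIrregularTerm.coeff_isLittleO {B : ℝ → ℝ} {L α c : ℝ} (hL : 0 < L)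
    (hα : 0 < α) (hBc : ContinuousOn B (Icc (-L) L))
    (hB : (fun t : ℝ => iteratedDeriv 0 B t - fallingFactorial α 0 * c * t ^ (α - (0 : ℕ)))
      =o[𝓝[>] 0] (fun t : ℝ => t ^ (α - (0 : ℕ)))) :
    B 0 = 0 ∧ (fun t : ℝ => B t - c * t ^ α) =o[𝓝[>] 0] (fun t : ℝ => t ^ α) := by
  have h1 : (fun t : ℝ => B t - c * t ^ α) =o[𝓝[>] 0] (fun t : ℝ => t ^ α) := by
    simpa [fallingFactorial] using hB
  refine ⟨?_, h1⟩
  have hpow : Tendsto (fun t : ℝ => t ^ α) (𝓝[>] 0) (𝓝 0) := by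
    have := (Real.continuousAt_rpow_const 0 α (Or.inr hα.le)).tendsto
    rw [Real.zero_rpow hα.ne'] at this
    exact this.mono_left nhdsWithin_le_nhds
  have h2 : Tendsto B (𝓝[>] 0) (𝓝 0) := by
    have := (h1.trans_tendsto hpow).add (hpow.const_mul c)
    simpa using this
  have h3 : Tendsto B (𝓝[>] 0) (𝓝 (B 0)) := by
    have : ContinuousAt B 0 := hBc.continuousAt (Icc_mem_nhds (by linarith) hL)
    exact this.tendsto.mono_left nhdsWithin_le_nhds
  exact tendsto_nhds_unique h3 h2

theorem IsLittleO.exists_abs_le_of_rpow {F : ℝ → ℝ} {a e : ℝ}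
    (hF : (fun t : ℝ => F t - a * t ^ e) =o[𝓝[>] 0] (fun t : ℝ => t ^ e)) :
    ∃ δ > 0, ∀ t, 0 < t → t < δ → |F t| ≤ (1 + |a|) * t ^ e := by
  have := hF.bound one_pos
  obtain ⟨δ, hδ, h⟩ := mem_nhdsGT_iff_exists_Ioo_subset.1 this
  refine ⟨δ, hδ, fun t h0 h1 => ?_⟩
  have h2 := h ⟨h0, h1⟩
  simp only [Set.mem_ofPred_eq, Real.norm_eq_abs, one_mul] at h2
  rw [abs_of_pos (Real.rpow_pos_of_pos h0 e)] at h2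
  have h3 : |a * t ^ e| = |a| * t ^ e := by
    rw [abs_mul, abs_of_pos (Real.rpow_pos_of_pos h0 e)]
  calc |F t| = |(F t - a * t ^ e) + a * t ^ e| := by ring_nf
    _ ≤ |F t - a * t ^ e| + |a * t ^ e| := abs_add_le _ _
    _ ≤ t ^ e + |a| * t ^ e := by rw [h3]; gcongr
    _ = _ := by ring

variable {d : ℕ}

/-- The even analytic term gives the smooth part S = A(‖·‖). The irregular part is R = B(‖·‖) + r,
whose two summands obey the same power bounds. -/
theorem IsIsotropicUpToRemainder.hasLocalExpansion
    {C : Fin 2 → Fin 2 → EuclideanSpace ℝ (Fin d) → ℝ} {L : ℝ} {α : Fin 2 → Fin 2 → ℝ}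
    (hL : 0 < L) (hC : IsIsotropicUpToRemainder C L α) (k l : Fin 2) (p : ℕ) :
    ∃ c : ℝ, (k = l → c ≠ 0) ∧ 0 < α k l ∧ (∀ i : ℕ, α k l ≠ 2 * (i : ℝ)) ∧
      HasLocalExpansion (C k l) (α k l) c p := by
  obtain ⟨c, K, r, hc, hK, hCK, hr0, hrs, hrp⟩ := hC.decomposition k l
  obtain ⟨A, B, hAB, hAe, hA, hBe, hBc, hBs, hBo⟩ := hK.decomposition
  refine ⟨c, hc, hK.exponent_pos, hK.exponent_not_even, ⟨?_⟩⟩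
  set a := α k l with ha
  obtain ⟨δ₁, hδ₁, B₁, hS⟩ := exists_norm_iteratedFDeriv_comp_norm_le_of_even
    (E := EuclideanSpace ℝ (Fin d)) (hA 0 (mem_univ _)) hAe p
  obtain ⟨hB0, hBo0⟩ := HasPrincipalIrregularTerm.coeff_isLittleO hL hK.exponent_pos hBc (hBo 0)
  choose δB hδB hBb using fun i : ℕ => IsLittleO.exists_abs_le_of_rpow (hBo i)
  obtain ⟨δ₂, hδ₂, hδ₂'⟩ : ∃ δ > 0, ∀ i ∈ Finset.range (p + 1), δ ≤ δB i := by
    refine ⟨(Finset.range (p + 1)).inf' Finset.nonempty_range_add_one δB, ?_, fun i hi => Finset.inf'_le _ hi⟩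
    rw [gt_iff_lt, Finset.lt_inf'_iff]
    exact fun i _ => hδB i
  set D : ℝ := ∑ i ∈ Finset.range (p + 1), (1 + |fallingFactorial a i * c|) with hD
  have hBb' : ∀ i ≤ p, ∀ t, 0 < t → t < min δ₂ (L / 2) →
      |iteratedDeriv i B t| ≤ D * t ^ (a - i) := by
    intro i hi t h0 h1
    have hi' : i ∈ Finset.range (p + 1) := Finset.mem_range.2 (Nat.lt_succ_of_le hi)
    refine (hBb i t h0 (h1.trans_le ((min_le_left _ _).trans (hδ₂' i hi')))).trans ?_
    refine mul_le_mul_of_nonneg_right ?_ (Real.rpow_nonneg h0.le _)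
    exact Finset.single_le_sum (f := fun i => 1 + |fallingFactorial a i * c|)
      (fun _ _ => by positivity) hi'
  obtain ⟨C', hC'⟩ := exists_norm_iteratedFDeriv_comp_norm_le (E := EuclideanSpace ℝ (Fin d))
    ((min_le_right δ₂ (L / 2)).trans_lt (half_lt_self hL)) hBs p hBb'
  obtain ⟨δ₃, hδ₃, hr⟩ := Metric.mem_nhdsWithin_iff.1 ((hrp p).bound one_pos)
  refine ⟨fun u => A ‖u‖, fun u => B ‖u‖ + r u, min δ₁ (min (min δ₂ (L / 2)) δ₃), by positivity,
    max B₁ (C' + 1), fun u => by rw [hCK, hAB]; ring, fun x hx => ?_, fun x hx hxδ => ?_, ?_⟩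
  · have := hS x (Metric.ball_subset_ball (min_le_left _ _) hx)
    exact ⟨this.1, this.2.trans (le_max_left _ _)⟩
  · have h1 := hC' x hx (hxδ.trans_le ((min_le_right _ _).trans (min_le_left _ _)))
    have hx0 : x ≠ 0 := norm_pos_iff.1 hx
    have h2 : ContDiffAt ℝ ((⊤ : ℕ∞) : WithTop ℕ∞) r x :=
      hrs.contDiffAt (isOpen_compl_singleton.mem_nhds hx0)
    refine ⟨h1.1.add h2, ?_⟩
    have hle : (p : WithTop ℕ∞) ≤ ((⊤ : ℕ∞) : WithTop ℕ∞) := by exact_mod_cast le_top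
    have h3 : ‖iteratedFDeriv ℝ p r x‖ ≤ 1 * ‖x‖ ^ (a - p) := by
      have := hr ⟨by
        rw [Metric.mem_ball, dist_zero_right]
        exact hxδ.trans_le ((min_le_right _ _).trans (min_le_right _ _)), hx0⟩
      rwa [Set.mem_ofPred_eq, Real.norm_of_nonneg (Real.rpow_nonneg hx.le _)] at this
    have h4 := iteratedFDeriv_add_apply (𝕜 := ℝ) (h1.1.of_le hle) (h2.of_le hle)
    calc ‖iteratedFDeriv ℝ p (fun u => B ‖u‖ + r u) x‖
        = ‖iteratedFDeriv ℝ p (fun u => B ‖u‖) x + iteratedFDeriv ℝ p r x‖ := congrArg _ h4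
      _ ≤ C' * ‖x‖ ^ (a - p) + 1 * ‖x‖ ^ (a - p) := (norm_add_le _ _).trans (add_le_add h1.2 h3)
      _ ≤ max B₁ (C' + 1) * ‖x‖ ^ (a - p) := by
        rw [← add_mul]
        exact mul_le_mul_of_nonneg_right (le_max_right _ _) (Real.rpow_nonneg hx.le _)
  · have h1 : (fun u : EuclideanSpace ℝ (Fin d) => B ‖u‖ - c * ‖u‖ ^ a) =o[𝓝 0]
        fun u => ‖u‖ ^ a := by
      rw [isLittleO_iff]
      intro ε hε
      obtain ⟨δ, hδ, h⟩ := mem_nhdsGT_iff_exists_Ioo_subset.1 (hBo0.bound hε)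
      filter_upwards [Metric.ball_mem_nhds (0 : EuclideanSpace ℝ (Fin d)) hδ] with u hu
      rcases eq_or_ne u 0 with rfl | hu0
      · simp [hB0, Real.zero_rpow hK.exponent_pos.ne']
      · exact h ⟨norm_pos_iff.2 hu0, by simpa using hu⟩
    refine (h1.add hr0).congr_left fun u => by ring

/-- A bound from the stencil weights alone, without smoothness: it serves when the stencil may reach
the singularity at the origin. -/
theorem abs_iterate_discreteLaplacian_le_of_forall (d M : ℕ) :
    ∃ W : ℝ, 0 ≤ W ∧ ∀ (h b : ℝ) (f : EuclideanSpace ℝ (Fin d) → ℝ) (u), 0 < h →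
      (∀ x, ‖x - u‖ ≤ M * h → |f x| ≤ b) →
      |(discreteLaplacian h)^[M] f u| ≤ W * ((1 / h ^ 2) ^ M * b) := by
  obtain ⟨N, w, k, hk, hz⟩ := exists_stencil d M
  refine ⟨∑ i, |w i|, by positivity, fun h b f u hh hf => ?_⟩
  rw [hz, abs_mul, abs_of_nonneg (by positivity), mul_left_comm]
  refine mul_le_mul_of_nonneg_left ?_ (by positivity)
  rw [Finset.sum_mul]
  refine (Finset.abs_sum_le_sum_abs _ _).trans (Finset.sum_le_sum fun i _ => ?_)
  rw [abs_mul]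
  refine mul_le_mul_of_nonneg_left (hf _ ?_) (abs_nonneg _)
  rw [add_sub_cancel_left, norm_smul, Real.norm_of_nonneg hh.le, mul_comm]
  exact mul_le_mul_of_nonneg_right (hk i) hh.le

/-- Size of the iterated discrete Laplacian of a covariance with an irregular term of exponent `α`,
at small lags. -/
theorem HasLocalExpansion.exists_abs_iterate_discreteLaplacian_le
    {f : EuclideanSpace ℝ (Fin d) → ℝ} {α c : ℝ} {q : ℕ} (hq : 1 ≤ q) (hα : 0 < α)
    (hf : HasLocalExpansion f α c (2 * q)) :
    ∃ δ > 0, ∃ D : ℝ, 0 ≤ D ∧ ∀ h u, 0 < h → h < δ → ‖u‖ < δ →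
      |(discreteLaplacian h)^[q] f u| ≤ D * (h + ‖u‖) ^ (-max (2 * q - α) 0) := by
  obtain ⟨S, R, δ, hδ, B, hfSR, hS, hR, hRo⟩ := hf.exists_decomposition
  set ρ := max (2 * q - α) 0 with hρ
  have hρ0 : 0 ≤ ρ := le_max_right _ _
  have hq' : (1 : ℝ) ≤ q := by exact_mod_cast hq
  have hB : 0 ≤ B := (norm_nonneg _).trans (hS 0 (Metric.mem_ball_self hδ)).2
  obtain ⟨δ', hδ', hRb⟩ := Metric.eventually_nhds_iff_ball.1 (hRo.bound one_pos)
  obtain ⟨W, hW, hWb⟩ := abs_iterate_discreteLaplacian_le_of_forall d q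
  have hff : f = fun s => S s + R s := funext hfSR
  set Kn : ℝ := W * ((1 + |c|) * (5 * q) ^ α * (4 * q + 1) ^ ρ) with hKn
  have hKn0 : 0 ≤ Kn := by positivity
  set Kf : ℝ := d ^ q * (B * 4 ^ ρ) with hKf
  have hKf0 : 0 ≤ Kf := by positivity
  refine ⟨min (min δ δ') 1 / (8 * q), by positivity, d ^ q * B + (Kn + Kf), by positivity,
    fun h u hh hhδ huδ => ?_⟩
  set δ₀ := min (min δ δ') 1 with hδ₀
  have hδ₀0 : 0 < δ₀ := by positivity
  have hδ₀1 : δ₀ ≤ 1 := min_le_right _ _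
  have hδ₀δ : δ₀ ≤ δ := (min_le_left _ _).trans (min_le_left _ _)
  have hδ₀δ' : δ₀ ≤ δ' := (min_le_left _ _).trans (min_le_right _ _)
  rw [lt_div_iff₀ (by positivity)] at hhδ huδ
  have hu0 := norm_nonneg u
  have huq : ‖u‖ ≤ ‖u‖ * q := le_mul_of_one_le_right hu0 hq'
  have hhq : h ≤ h * q := le_mul_of_one_le_right hh.le hq'
  have hsum1 : h + ‖u‖ ≤ 1 := by nlinarith
  have hsum0 : 0 < h + ‖u‖ := by linarith
  -- Since ρ ≥ 0 and h + ‖u‖ ≤ 1, the bounded contribution of S is absorbed by the power; hence the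
  -- maximum with 0 in the exponent.
  have hpow1 : 1 ≤ (h + ‖u‖) ^ (-ρ) :=
    Real.one_le_rpow_of_pos_of_le_one_of_nonpos hsum0 hsum1 (by linarith)
  rw [hff, iterate_discreteLaplacian_add]
  refine (abs_add_le _ _).trans ?_
  rw [add_mul (d ^ q * B : ℝ)]
  refine add_le_add ?_ ?_
  · refine (abs_iterate_discreteLaplacian_le (R := δ / 2) (B := B) hh (by nlinarith)
      fun x hx => hS x ?_).trans (le_mul_of_one_le_right (by positivity) hpow1)
    rw [Metric.mem_ball, dist_eq_norm] at hx
    rw [Metric.mem_ball, dist_zero_right]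
    calc ‖x‖ = ‖(x - u) + u‖ := by simp
      _ ≤ ‖x - u‖ + ‖u‖ := norm_add_le _ _
      _ < δ := by nlinarith
  rw [add_mul Kn]
  have hexp : ∀ y : ℝ, 0 < y → y ≤ 1 → y ^ (α - (2 * q : ℕ)) ≤ y ^ (-ρ) := by
    intro y h0 h1
    refine Real.rpow_le_rpow_of_exponent_ge h0 h1 ?_
    push_cast
    have := le_max_left (2 * q - α) 0
    linarith
  -- Near lags: every stencil point has norm at most 5qh, so R = O(h^α) there, and h + ‖u‖ is
  -- comparable to h. Far lags: the ball of radius ‖u‖/2 > 2qh about u avoids the origin, and the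
  -- derivatives of order 2q control the Laplacian.
  rcases le_or_gt ‖u‖ (4 * q * h) with hnear | hfar
  · refine le_trans ?_ (le_add_of_nonneg_right (by positivity))
    have hbound : ∀ x, ‖x - u‖ ≤ q * h → |R x| ≤ (1 + |c|) * (5 * q * h) ^ α := by
      intro x hx
      have hx1 : ‖x‖ ≤ 5 * q * h := by
        calc ‖x‖ = ‖(x - u) + u‖ := by simp
          _ ≤ ‖x - u‖ + ‖u‖ := norm_add_le _ _
          _ ≤ _ := by linarith
      have hx2 := hRb x (by rw [Metric.mem_ball, dist_zero_right]; nlinarith)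
      rw [Real.norm_eq_abs, one_mul, Real.norm_of_nonneg (Real.rpow_nonneg (norm_nonneg _) _)] at hx2
      have hx3 : ‖x‖ ^ α ≤ (5 * q * h) ^ α := Real.rpow_le_rpow (norm_nonneg _) hx1 hα.le
      calc |R x| = |(R x - c * ‖x‖ ^ α) + c * ‖x‖ ^ α| := by ring_nf
        _ ≤ |R x - c * ‖x‖ ^ α| + |c * ‖x‖ ^ α| := abs_add_le _ _
        _ ≤ ‖x‖ ^ α + |c| * ‖x‖ ^ α := by
          rw [abs_mul, abs_of_nonneg (Real.rpow_nonneg (norm_nonneg x) α)]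
          gcongr
        _ = (1 + |c|) * ‖x‖ ^ α := by ring
        _ ≤ _ := by gcongr
    refine (hWb h _ R u hh hbound).trans ?_
    rw [hKn, mul_assoc W]
    refine mul_le_mul_of_nonneg_left ?_ hW
    have e1 : (1 / h ^ 2) ^ q * ((1 + |c|) * (5 * q * h) ^ α) =
        (1 + |c|) * (5 * q) ^ α * h ^ (α - (2 * q : ℕ)) := by
      rw [Real.mul_rpow (by positivity) hh.le, Real.rpow_sub hh, Real.rpow_natCast, one_div,
        inv_pow, ← pow_mul]
      field_simp
    rw [e1, mul_assoc ((1 + |c|) * (5 * q) ^ α)]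
    refine mul_le_mul_of_nonneg_left ((hexp h hh (by linarith)).trans ?_) (by positivity)
    have h3 : ((4 * q + 1) * h) ^ (-ρ) ≤ (h + ‖u‖) ^ (-ρ) :=
      Real.rpow_le_rpow_of_nonpos hsum0 (by linarith) (by linarith)
    calc h ^ (-ρ) = (4 * q + 1) ^ ρ * ((4 * q + 1) * h) ^ (-ρ) := by
          rw [Real.mul_rpow (by positivity) hh.le, ← mul_assoc, ← Real.rpow_add (by positivity)]
          simp
      _ ≤ _ := by gcongr
  · refine le_trans ?_ (le_add_of_nonneg_left (by positivity))
    rw [hKf, mul_assoc (d ^ q : ℝ)]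
    refine abs_iterate_discreteLaplacian_le (R := ‖u‖ / 2) hh (by linarith) fun x hx => ?_
    rw [Metric.mem_ball, dist_eq_norm] at hx
    have hx1 : ‖u‖ / 2 < ‖x‖ := by
      have : ‖u‖ ≤ ‖x‖ + ‖x - u‖ := by
        calc ‖u‖ = ‖x - (x - u)‖ := by simp
          _ ≤ _ := norm_sub_le _ _
      linarith
    have hx2 : ‖x‖ < 2 * ‖u‖ := by
      have : ‖x‖ ≤ ‖x - u‖ + ‖u‖ := by
        calc ‖x‖ = ‖(x - u) + u‖ := by simp
          _ ≤ _ := norm_add_le _ _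
      linarith
    have hx0 : 0 < ‖x‖ := by linarith
    have h1 := hR x hx0 (by nlinarith)
    refine ⟨h1.1, h1.2.trans ?_⟩
    rw [mul_assoc]
    refine mul_le_mul_of_nonneg_left ((hexp _ hx0 (by nlinarith)).trans ?_) hB
    have h2 : ‖x‖ ^ (-ρ) ≤ ((h + ‖u‖) / 4) ^ (-ρ) :=
      Real.rpow_le_rpow_of_nonpos (by positivity) (by nlinarith) (by linarith)
    refine h2.trans (le_of_eq ?_)
    rw [Real.div_rpow hsum0.le (by norm_num), Real.rpow_neg (by norm_num : (0 : ℝ) ≤ 4)]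
    field_simp

/-- Scaling limit of the iterated discrete Laplacian of a covariance function. -/
theorem HasLocalExpansion.tendsto_iterate_discreteLaplacian
    {f : EuclideanSpace ℝ (Fin d) → ℝ} {α c : ℝ} {q : ℕ} (hαq : α < 2 * q)
    (hf : HasLocalExpansion f α c (2 * q)) (u : EuclideanSpace ℝ (Fin d)) :
    Tendsto (fun h : ℝ => h ^ (2 * q - α) * (discreteLaplacian h)^[q] f (h • u)) (𝓝[>] 0)
      (𝓝 (c * (discreteLaplacian 1)^[q] (fun x => ‖x‖ ^ α) u)) := by
  obtain ⟨S, R, δ, hδ, B, hfSR, hS, -, hRo⟩ := hf.exists_decomposition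
  have hff : f = fun s => S s + R s := funext hfSR
  obtain ⟨N, w, k, hk, hz⟩ := exists_stencil d q
  have hSlim : Tendsto (fun h : ℝ => h ^ (2 * q - α) * (discreteLaplacian h)^[q] S (h • u)) (𝓝[>] 0)
      (𝓝 0) := by
    have hpow : Tendsto (fun h : ℝ => h ^ (2 * q - α)) (𝓝[>] 0) (𝓝 0) := by
      have := (Real.continuousAt_rpow_const 0 (2 * q - α) (Or.inr (by linarith))).tendsto
      rw [Real.zero_rpow (by linarith)] at this
      exact this.mono_left nhdsWithin_le_nhds
    refine hpow.zero_mul_isBoundedUnder_le ?_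
    refine isBoundedUnder_of_eventually_le (a := d ^ q * B) ?_
    have : Ioo 0 (δ / (2 * q + 1 + ‖u‖)) ∈ 𝓝[>] (0 : ℝ) := Ioo_mem_nhdsGT (by positivity)
    filter_upwards [this] with h hh
    have h2 := (lt_div_iff₀ (by positivity)).1 hh.2
    refine abs_iterate_discreteLaplacian_le (R := δ - h * ‖u‖) hh.1 (by nlinarith [hh.1])
      fun x hx => hS x ?_
    rw [Metric.mem_ball, dist_eq_norm] at hx
    rw [Metric.mem_ball, dist_zero_right]
    calc ‖x‖ = ‖(x - h • u) + h • u‖ := by simp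
      _ ≤ ‖x - h • u‖ + ‖h • u‖ := norm_add_le _ _
      _ < δ := by rw [norm_smul, Real.norm_of_nonneg hh.1.le]; linarith
  have hRlim : Tendsto (fun h : ℝ => h ^ (2 * q - α) * (discreteLaplacian h)^[q] R (h • u)) (𝓝[>] 0)
      (𝓝 (c * (discreteLaplacian 1)^[q] (fun x => ‖x‖ ^ α) u)) := by
    have hpt : ∀ x : EuclideanSpace ℝ (Fin d),
        Tendsto (fun h : ℝ => h ^ (-α) * R (h • x)) (𝓝[>] 0) (𝓝 (c * ‖x‖ ^ α)) := by
      intro x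
      have hten : Tendsto (fun h : ℝ => h • x) (𝓝[>] 0) (𝓝 0) := by
        have : Tendsto (fun h : ℝ => h • x) (𝓝 0) (𝓝 ((0 : ℝ) • x)) :=
          (continuous_id.smul continuous_const).tendsto 0
        rw [zero_smul] at this
        exact this.mono_left nhdsWithin_le_nhds
      have h1 := hRo.comp_tendsto hten
      have h2 : (fun h : ℝ => R (h • x) - c * ‖h • x‖ ^ α) =o[𝓝[>] 0] fun h : ℝ => h ^ α := by
        refine h1.trans_isBigO (IsBigO.of_bound (‖x‖ ^ α) ?_)
        filter_upwards [self_mem_nhdsWithin] with h hh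
        have hh' : (0 : ℝ) < h := hh
        simp only [Function.comp, norm_smul, Real.norm_of_nonneg hh'.le]
        rw [Real.mul_rpow hh'.le (norm_nonneg _), norm_mul,
          Real.norm_of_nonneg (Real.rpow_nonneg (norm_nonneg x) _), mul_comm]
      have h3 := h2.tendsto_div_nhds_zero
      have h4 := h3.add_const (c * ‖x‖ ^ α)
      rw [zero_add] at h4
      refine h4.congr' ?_
      filter_upwards [self_mem_nhdsWithin] with h hh
      have hh' : (0 : ℝ) < h := hh
      rw [norm_smul, Real.norm_of_nonneg hh'.le, Real.mul_rpow hh'.le (norm_nonneg _),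
        Real.rpow_neg hh'.le]
      have := (Real.rpow_pos_of_pos hh' α).ne'
      field_simp
      ring
    have hlim : Tendsto (fun h : ℝ => ∑ i, w i * (h ^ (-α) * R (h • (u + k i)))) (𝓝[>] 0)
        (𝓝 (∑ i, w i * (c * ‖u + k i‖ ^ α))) :=
      tendsto_finsetSum _ fun i _ => (hpt _).const_mul _
    have e : c * (discreteLaplacian 1)^[q] (fun x => ‖x‖ ^ α) u = ∑ i, w i * (c * ‖u + k i‖ ^ α) := by
      rw [hz, Finset.mul_sum, Finset.mul_sum]
      refine Finset.sum_congr rfl fun i _ => ?_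
      simp only [one_smul]
      ring
    rw [e]
    refine hlim.congr' ?_
    filter_upwards [self_mem_nhdsWithin] with h hh
    have hh' : (0 : ℝ) < h := hh
    rw [hz, Finset.mul_sum, Finset.mul_sum]
    refine Finset.sum_congr rfl fun i _ => ?_
    rw [smul_add]
    have e2 : h ^ (2 * q - α) * (1 / h ^ 2) ^ q = h ^ (-α) := by
      have : (2 * q - α : ℝ) = ((2 * q : ℕ) : ℝ) + (-α) := by push_cast; ring
      rw [this, Real.rpow_add hh', Real.rpow_natCast, one_div, inv_pow, ← pow_mul]
      field_simp
    rw [← e2]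
    ring
  have := hSlim.add hRlim
  rw [zero_add] at this
  refine this.congr fun h => ?_
  rw [hff, iterate_discreteLaplacian_add]
  ring

end LocalCovariance

/-! ### The scaling limit does not vanish identically. -/

section Nondegeneracy

/-- `|t|^α` is not analytic at `0` unless `α` is an even integer. -/
theorem not_analyticAt_abs_rpow {α : ℝ} (hα : 0 < α) (heven : ∀ k : ℕ, α ≠ 2 * (k : ℝ)) :
    ¬ AnalyticAt ℝ (fun t : ℝ => |t| ^ α) 0 := by
  intro h
  -- Analyticity would give |t|^α = t^n g(t) with g(0) ≠ 0. Comparing orders as t ↓ 0 forces α = n,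
  -- and the two one-sided limits of g then give (−1)^n = 1.
  obtain ⟨n, g, hg, hg0, hfg⟩ := h.exists_eventuallyEq_pow_smul_nonzero_iff.2 (by
    intro h0
    obtain ⟨δ, hδ, h1⟩ := Metric.eventually_nhds_iff_ball.1 h0
    have := h1 (δ / 2) (by simp [abs_of_pos hδ, hδ])
    rw [abs_of_pos (half_pos hδ)] at this
    exact (Real.rpow_pos_of_pos (half_pos hδ) α).ne' this)
  simp only [sub_zero, smul_eq_mul] at hfg
  have hgR : Tendsto g (𝓝[>] 0) (𝓝 (g 0)) := hg.continuousAt.tendsto.mono_left nhdsWithin_le_nhds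
  have hgL : Tendsto g (𝓝[<] 0) (𝓝 (g 0)) := hg.continuousAt.tendsto.mono_left nhdsWithin_le_nhds
  have hfR : ∀ᶠ t in 𝓝[>] (0 : ℝ), t ^ α = t ^ (n : ℝ) * g t := by
    filter_upwards [hfg.filter_mono nhdsWithin_le_nhds, self_mem_nhdsWithin] with t ht h0
    rwa [abs_of_pos h0, ← Real.rpow_natCast] at ht
  have hpow : ∀ e : ℝ, 0 < e → Tendsto (fun t : ℝ => t ^ e) (𝓝[>] 0) (𝓝 0) := by
    intro e he
    have := (Real.continuousAt_rpow_const 0 e (Or.inr he.le)).tendsto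
    rw [Real.zero_rpow he.ne'] at this
    exact this.mono_left nhdsWithin_le_nhds
  have hαn : α = n := by
    rcases lt_trichotomy α n with hlt | heq | hgt
    · have h1 := (hpow (n - α) (by linarith)).mul hgR
      rw [zero_mul] at h1
      have h2 : Tendsto (fun _ : ℝ => (1 : ℝ)) (𝓝[>] 0) (𝓝 0) := by
        refine h1.congr' ?_
        filter_upwards [hfR, self_mem_nhdsWithin] with t ht h0
        have h0' : (0 : ℝ) < t := h0
        have hne := (Real.rpow_pos_of_pos h0' α).ne'
        rw [Real.rpow_sub h0', div_mul_eq_mul_div, ← ht, div_self hne]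
      exact absurd (tendsto_nhds_unique h2 tendsto_const_nhds) (by norm_num)
    · exact heq
    · have h1 := hpow (α - n) (by linarith)
      refine absurd (tendsto_nhds_unique (hgR.congr' ?_) h1) hg0
      filter_upwards [hfR, self_mem_nhdsWithin] with t ht h0
      have h0' : (0 : ℝ) < t := h0
      have hne := (Real.rpow_pos_of_pos h0' (n : ℝ)).ne'
      rw [Real.rpow_sub h0', ht, mul_div_cancel_left₀ _ hne]
  subst hαn
  have hg1 : g 0 = 1 := by
    refine tendsto_nhds_unique (hgR.congr' ?_) tendsto_const_nhds
    filter_upwards [hfR, self_mem_nhdsWithin] with t ht h0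
    have hne := (Real.rpow_pos_of_pos (show (0 : ℝ) < t from h0) (n : ℝ)).ne'
    exact mul_left_cancel₀ hne (by rw [← ht, mul_one])
  have hgm : g 0 = (-1) ^ n := by
    refine tendsto_nhds_unique (hgL.congr' ?_) tendsto_const_nhds
    filter_upwards [hfg.filter_mono nhdsWithin_le_nhds, self_mem_nhdsWithin] with t ht h0
    have h0' : t < 0 := h0
    rw [abs_of_neg h0', Real.rpow_natCast, neg_pow, mul_comm] at ht
    exact (mul_left_cancel₀ (pow_ne_zero n h0'.ne) ht).symm
  have hn : Even n := by
    by_contra hodd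
    rw [Nat.not_even_iff_odd] at hodd
    rw [hg1, hodd.neg_one_pow] at hgm
    norm_num at hgm
  obtain ⟨k, rfl⟩ := hn
  exact heven k (by push_cast; ring)

/-- The squared norm along a line is a polynomial in t, positive at t = 0 when x ≠ 0, so its real
powers are analytic there. -/
theorem AnalyticAt.norm_add_smul_rpow {E : Type*} [NormedAddCommGroup E] [InnerProductSpace ℝ E]
    {x : E} (hx : x ≠ 0) (e : E) (α : ℝ) : AnalyticAt ℝ (fun t : ℝ => ‖x + t • e‖ ^ α) 0 := by
  set P : ℝ → ℝ := fun t => ‖x‖ ^ 2 + 2 * (t * inner ℝ x e) + t ^ 2 * ‖e‖ ^ 2 with hP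
  have hPn : ∀ t : ℝ, ‖x + t • e‖ ^ 2 = P t := by
    intro t
    rw [norm_add_sq_real, inner_smul_right, norm_smul, mul_pow, Real.norm_eq_abs, sq_abs]
  have hid : AnalyticAt ℝ (fun t : ℝ => t) 0 := analyticAt_id
  have hPa : AnalyticAt ℝ P 0 := by
    exact (analyticAt_const.add (analyticAt_const.mul (hid.mul analyticAt_const))).add
      ((hid.pow 2).mul analyticAt_const)
  have hP0 : 0 < P 0 := by
    simp only [hP]
    have := norm_pos_iff.2 hx
    simp [hx]
  have h1 : AnalyticAt ℝ (fun t => Real.exp (Real.log (P t) * (α / 2))) 0 :=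
    ((hPa.log hP0).mul analyticAt_const).rexp
  refine h1.congr ?_
  filter_upwards [hPa.continuousAt.eventually (lt_mem_nhds hP0)] with t ht
  rw [← Real.rpow_def_of_pos ht, ← hPn, ← Real.rpow_natCast, ← Real.rpow_mul (norm_nonneg _)]
  congr 1
  push_cast
  ring

variable {d : ℕ}

/-- Along the `g`-th axis the `M`-th discrete Laplacian of `‖·‖^α` has a singularity at `-M e_g`,
and none beyond. -/
theorem analyticAt_iterate_discreteLaplacian_norm_rpow_iff {α : ℝ} (hα : 0 < α)
    (heven : ∀ k : ℕ, α ≠ 2 * (k : ℝ)) (g : Fin d) (M : ℕ) (x : EuclideanSpace ℝ (Fin d))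
    (hx : x g ≤ -M) :
    AnalyticAt ℝ (fun t : ℝ => (discreteLaplacian 1)^[M] (fun y => ‖y‖ ^ α)
      (x + t • EuclideanSpace.single g (1 : ℝ))) 0 ↔
      x ≠ (-M : ℝ) • EuclideanSpace.single g (1 : ℝ) := by
  induction M generalizing x with
  | zero =>
    simp only [Function.iterate_zero, id, Nat.cast_zero, neg_zero, zero_smul]
    constructor
    · rintro h rfl
      refine not_analyticAt_abs_rpow hα heven ?_
      refine h.congr (Eventually.of_forall fun t => ?_)
      simp [norm_smul]
    · exact fun h => AnalyticAt.norm_add_smul_rpow h _ _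
  | succ M ih =>
    set e : Fin d → EuclideanSpace ℝ (Fin d) := fun i => EuclideanSpace.single i (1 : ℝ) with he
    set F := (discreteLaplacian (d := d) 1)^[M] (fun y => ‖y‖ ^ α) with hF
    set φ : EuclideanSpace ℝ (Fin d) → ℝ → ℝ := fun y t => F (y + t • e g) with hφ
    push_cast at hx
    have hgood : ∀ y : EuclideanSpace ℝ (Fin d), y g < -M → AnalyticAt ℝ (φ y) 0 := by
      intro y hy
      refine (ih y hy.le).2 ?_
      rintro rfl
      simp at hy
    have hxi : ∀ i, (x - e i) g < -M := by
      intro i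
      simp only [he, PiLp.sub_apply, PiLp.single_apply]
      split_ifs <;> linarith
    have hxi' : ∀ i, i ≠ g → (x + e i) g < -M := by
      intro i hi
      simp only [he, PiLp.add_apply, PiLp.single_apply, if_neg hi.symm]
      linarith
    -- Among x and its neighbours only x + e_g can have `g`-th coordinate −M; the others lie
    -- strictly beyond, where the previous iterate is analytic along the axis. So analyticity at x
    -- is decided by x + e_g alone.
    have hrest : AnalyticAt ℝ (fun t => (∑ i ∈ Finset.univ.erase g,
        (φ (x + e i) t + φ (x - e i) t - 2 * φ x t)) + (φ (x - e g) t - 2 * φ x t)) 0 := by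
      have hx0 : AnalyticAt ℝ (φ x) 0 := hgood x (by linarith)
      refine AnalyticAt.add (Finset.analyticAt_fun_sum _ fun i hi => ?_) ?_
      · exact ((hgood _ (hxi' i (Finset.ne_of_mem_erase hi))).add (hgood _ (hxi i))).sub
          (analyticAt_const.mul hx0)
      · exact (hgood _ (hxi g)).sub (analyticAt_const.mul hx0)
    have hsplit : (fun t : ℝ => (discreteLaplacian 1)^[M + 1] (fun y => ‖y‖ ^ α) (x + t • e g)) =
        fun t => φ (x + e g) t + ((∑ i ∈ Finset.univ.erase g,
        (φ (x + e i) t + φ (x - e i) t - 2 * φ x t)) + (φ (x - e g) t - 2 * φ x t)) := by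
      funext t
      rw [Function.iterate_succ_apply', discreteLaplacian,
        ← Finset.sum_erase_add _ _ (Finset.mem_univ g)]
      simp only [hφ, he, one_smul, one_pow, div_one, one_mul, ← hF]
      have e1 : ∀ i, x + t • (EuclideanSpace.single g (1 : ℝ) : EuclideanSpace ℝ (Fin d)) +
          EuclideanSpace.single i 1 = x + EuclideanSpace.single i 1 +
          t • EuclideanSpace.single g 1 := fun i => by abel
      have e2 : ∀ i, x + t • (EuclideanSpace.single g (1 : ℝ) : EuclideanSpace ℝ (Fin d)) -
          EuclideanSpace.single i 1 = x - EuclideanSpace.single i 1 +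
          t • EuclideanSpace.single g 1 := fun i => by abel
      simp only [e1, e2]
      ring
    have hiff : AnalyticAt ℝ (fun t : ℝ => (discreteLaplacian 1)^[M + 1] (fun y => ‖y‖ ^ α)
        (x + t • e g)) 0 ↔ AnalyticAt ℝ (φ (x + e g)) 0 := by
      rw [hsplit]
      constructor
      · intro h
        refine (h.sub hrest).congr (Eventually.of_forall fun t => ?_)
        simp
      · exact fun h => h.add hrest
    rw [hiff, ih (x + e g) (by
      simp only [he, PiLp.add_apply, PiLp.single_apply, if_true]; linarith)]
    rw [not_iff_not, ← eq_sub_iff_add_eq]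
    have : (-M : ℝ) • (EuclideanSpace.single g (1 : ℝ) : EuclideanSpace ℝ (Fin d)) - e g =
        (-((M + 1 : ℕ) : ℝ)) • EuclideanSpace.single g (1 : ℝ) := by
      simp only [he]; push_cast; module
    rw [this]

theorem exists_iterate_discreteLaplacian_norm_rpow_ne_zero (hd : 1 ≤ d) {α : ℝ} (hα : 0 < α)
    (heven : ∀ k : ℕ, α ≠ 2 * (k : ℝ)) (M : ℕ) :
    ∃ u : EuclideanSpace ℝ (Fin d), (discreteLaplacian 1)^[M] (fun y => ‖y‖ ^ α) u ≠ 0 := by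
  by_contra! h
  have := (analyticAt_iterate_discreteLaplacian_norm_rpow_iff hα heven (⟨0, hd⟩ : Fin d) M
    ((-M : ℝ) • EuclideanSpace.single ⟨0, hd⟩ (1 : ℝ)) (by simp)).1
    (by simp only [h]; exact analyticAt_const)
  exact this rfl

end Nondegeneracy

/-! ### Fourth moments of Gaussian vectors. -/

section GaussianMoments

theorem integral_pow_four_gaussianReal (v : NNReal) :
    ∫ x, x ^ 4 ∂(gaussianReal 0 v) = 3 * (v : ℝ) ^ 2 := by
  have h := iteratedDeriv_mgf_zero (X := id) (μ := gaussianReal 0 v)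
    (by rw [integrableExpSet_id_gaussianReal]; simp) 4
  rw [mgf_id_gaussianReal] at h
  simp only [Pi.pow_apply, id, zero_mul, zero_add] at h
  rw [← h]
  -- Differentiation preserves the form p(t) exp(v t²/2), replacing p by p' + v t p. Four passes
  -- starting from p = 1 give the fourth derivative of the moment generating function.
  have hder : ∀ (p p' : ℝ → ℝ), (∀ t, HasDerivAt p (p' t) t) →
      deriv (fun t => p t * Real.exp (v * t ^ 2 / 2)) =
        fun t => (p' t + p t * (v * t)) * Real.exp (v * t ^ 2 / 2) := by
    intro p p' hp
    funext t
    have h1 : HasDerivAt (fun t : ℝ => (v : ℝ) * t ^ 2 / 2) (v * t) t := by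
      have := (((hasDerivAt_id t).pow 2).const_mul (v : ℝ)).div_const 2
      convert! this using 1
      simp; ring
    refine ((hp t).mul h1.exp).deriv.trans ?_
    ring
  have hid : ∀ t : ℝ, HasDerivAt (fun t : ℝ => t) 1 t := hasDerivAt_id
  have d1 : deriv (fun t : ℝ => Real.exp (v * t ^ 2 / 2)) =
      fun t => (v * t) * Real.exp (v * t ^ 2 / 2) := by
    have := hder (fun _ => 1) (fun _ => 0) (fun t => hasDerivAt_const t 1)
    simpa using this
  have d2 := hder (fun t => v * t) (fun _ => v * 1) (fun t => (hid t).const_mul _)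
  have d3 := hder (fun t => v * 1 + v * t * (v * t))
    (fun t => v * 1 * (v * t) + v * t * (v * 1))
    (fun t => (((hid t).const_mul _).mul ((hid t).const_mul _)).const_add _)
  have d4 := hder (fun t => v * 1 * (v * t) + v * t * (v * 1) + (v * 1 + v * t * (v * t)) * (v * t))
    (fun t => v * 1 * (v * 1) + v * 1 * (v * 1) +
      ((v * 1 * (v * t) + v * t * (v * 1)) * (v * t) + (v * 1 + v * t * (v * t)) * (v * 1)))
    (fun t => ((((hid t).const_mul (v : ℝ)).const_mul (v * 1 : ℝ)).add
      (((hid t).const_mul (v : ℝ)).mul_const (v * 1 : ℝ))).add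
      (((((hid t).const_mul (v : ℝ)).mul ((hid t).const_mul (v : ℝ))).const_add _).mul
        ((hid t).const_mul _)))
  rw [iteratedDeriv_succ', iteratedDeriv_succ', iteratedDeriv_succ', iteratedDeriv_succ',
    iteratedDeriv_zero, d1, d2, d3, d4]
  simp
  ring

variable {Ω : Type*} [MeasurableSpace Ω] {P : Measure Ω}

theorem ProbabilityTheory.HasGaussianLaw.integral_pow_four {X : Ω → ℝ} (hX : HasGaussianLaw X P)
    (h0 : ∫ ω, X ω ∂P = 0) : ∫ ω, X ω ^ 4 ∂P = 3 * (∫ ω, X ω ^ 2 ∂P) ^ 2 := by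
  have := hX.isProbabilityMeasure
  have hvar : Var[X; P] = ∫ ω, X ω ^ 2 ∂P := by
    rw [variance_of_integral_eq_zero hX.aemeasurable h0]
  have hmap := hX.map_eq_gaussianReal
  rw [h0] at hmap
  have h1 : ∫ ω, X ω ^ 4 ∂P = ∫ x, x ^ 4 ∂(P.map X) := by
    rw [integral_map hX.aemeasurable (by fun_prop)]
  rw [h1, hmap, integral_pow_four_gaussianReal, Real.coe_toNNReal _ (variance_nonneg _ _), hvar]

/-- Isserlis' formula for the fourth order moments of a centred Gaussian vector. -/
theorem integral_mul_mul_mul_of_gaussian {X : Fin 4 → Ω → ℝ}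
    (hX : ∀ a : Fin 4 → ℝ, HasGaussianLaw (fun ω => ∑ i, a i * X i ω) P)
    (h0 : ∀ i, ∫ ω, X i ω ∂P = 0) :
    ∫ ω, X 0 ω * X 1 ω * (X 2 ω * X 3 ω) ∂P =
      (∫ ω, X 0 ω * X 1 ω ∂P) * (∫ ω, X 2 ω * X 3 ω ∂P) +
      (∫ ω, X 0 ω * X 2 ω ∂P) * (∫ ω, X 1 ω * X 3 ω ∂P) +
      (∫ ω, X 0 ω * X 3 ω ∂P) * (∫ ω, X 1 ω * X 2 ω ∂P) := by
  have hXi : ∀ i, HasGaussianLaw (X i) P := by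
    intro i
    have := hX (Pi.single i 1)
    simpa [Pi.single_apply] using this
  have hL2 : ∀ i, MemLp (X i) 2 P := fun i => (hXi i).memLp_two
  have hint : ∀ i j, Integrable (fun ω => X i ω * X j ω) P := fun i j =>
    (hL2 i).integrable_mul (hL2 j)
  have hsum0 : ∀ a : Fin 4 → ℝ, ∫ ω, ∑ i, a i * X i ω ∂P = 0 := by
    intro a
    rw [integral_finsetSum _ fun i _ => ((hXi i).integrable).const_mul _]
    simp [integral_const_mul, h0]
  have h4 : ∀ a : Fin 4 → ℝ, ∫ ω, (∑ i, a i * X i ω) ^ 4 ∂P =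
      3 * (∑ i, ∑ j, a i * a j * ∫ ω, X i ω * X j ω ∂P) ^ 2 := by
    intro a
    rw [(hX a).integral_pow_four (hsum0 a)]
    congr 2
    have : ∀ ω, (∑ i, a i * X i ω) ^ 2 = ∑ i, ∑ j, a i * a j * (X i ω * X j ω) := by
      intro ω
      rw [sq, Finset.sum_mul_sum]
      exact Finset.sum_congr rfl fun i _ => Finset.sum_congr rfl fun j _ => by ring
    simp only [this]
    rw [integral_finsetSum _ fun i _ => integrable_finsetSum _ fun j _ => (hint i j).const_mul _]
    refine Finset.sum_congr rfl fun i _ => ?_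
    rw [integral_finsetSum _ fun j _ => (hint i j).const_mul _]
    simp only [integral_const_mul]
  have hI4 : ∀ a : Fin 4 → ℝ, Integrable (fun ω => (∑ i, a i * X i ω) ^ 4) P := by
    intro a
    have := ((hX a).memLp (p := 4) (by norm_num)).integrable_norm_pow (by norm_num)
    refine this.congr (Eventually.of_forall fun ω => ?_)
    simp only [Real.norm_eq_abs]
    exact Even.pow_abs (by decide) _
  -- Polarization over the eight sign patterns with first sign +1, each weighted by the product of
  -- its signs. Only x₀x₁x₂x₃ survives, with coefficient 8 · 4! = 192; everything reduces to fourth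
  -- powers of scalar Gaussians.
  set s : Fin 8 → Fin 4 → ℝ := ![![1, 1, 1, 1], ![1, 1, 1, -1], ![1, 1, -1, 1], ![1, 1, -1, -1],
    ![1, -1, 1, 1], ![1, -1, 1, -1], ![1, -1, -1, 1], ![1, -1, -1, -1]] with hs
  set ε : Fin 8 → ℝ := ![1, -1, -1, 1, -1, 1, 1, -1] with hε
  have hpol : ∀ ω, X 0 ω * X 1 ω * (X 2 ω * X 3 ω) =
      1 / 192 * ∑ k, ε k * (∑ i, s k i * X i ω) ^ 4 := by
    intro ω
    simp only [hs, hε, Fin.sum_univ_succ, Fin.sum_univ_zero]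
    simp
    ring
  simp only [hpol]
  rw [integral_const_mul, integral_finsetSum _ fun k _ => (hI4 (s k)).const_mul _]
  simp only [integral_const_mul, h4]
  have hsymm : ∀ i j, ∫ ω, X i ω * X j ω ∂P = ∫ ω, X j ω * X i ω ∂P := fun i j => by
    simp only [mul_comm]
  simp only [hs, hε, Fin.sum_univ_succ, Fin.sum_univ_zero]
  simp
  rw [hsymm 1 0, hsymm 2 0, hsymm 3 0, hsymm 2 1, hsymm 3 1, hsymm 3 2]
  ring

end GaussianMoments

/-! ### Second and fourth order structure of the Laplacian fields. -/

section LaplacianField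

variable {d : ℕ} {Ω : Type*} [MeasurableSpace Ω] {P : Measure Ω}
  {X W : EuclideanSpace ℝ (Fin d) → Ω → ℝ} {C : Fin 2 → Fin 2 → EuclideanSpace ℝ (Fin d) → ℝ}

/-- The `m`-th discrete Laplacian of the `k`-th component of the field `(X, W)`. -/
noncomputable def laplacianField (X W : EuclideanSpace ℝ (Fin d) → Ω → ℝ) (m : ℕ) (h : ℝ)
    (k : Fin 2) (s : EuclideanSpace ℝ (Fin d)) (ω : Ω) : ℝ :=
  (discreteLaplacian h)^[m] (fun t => (![X, W] : Fin 2 → _) k t ω) s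

theorem ProbabilityTheory.IsGaussianProcess.hasGaussianLaw_linearCombination {T ι : Type*}
    [Fintype ι] {Z : T → Ω → ℝ} (hZ : IsGaussianProcess Z P) (a : ι → ℝ) (t : ι → T) :
    HasGaussianLaw (fun ω => ∑ i, a i * Z (t i) ω) P := by
  have h := ((hZ.comp_right t).smul a).hasGaussianLaw_fun_sum (I := Finset.univ)
  simpa using h

theorem IsStationaryGRF.hasGaussianLaw_linearCombination (hZ : IsStationaryGRF P X W C)
    {ι : Type*} [Fintype ι] (m : ℕ) (h : ℝ) (a : ι → ℝ) (k : ι → Fin 2)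
    (s : ι → EuclideanSpace ℝ (Fin d)) :
    HasGaussianLaw (fun ω => ∑ i, a i * laplacianField X W m h (k i) (s i) ω) P := by
  obtain ⟨N, w, v, -, hz⟩ := exists_stencil d m
  have := hZ.gaussian.hasGaussianLaw_linearCombination (ι := ι × Fin N)
    (fun p => a p.1 * ((1 / h ^ 2) ^ m * w p.2)) (fun p => (k p.1, s p.1 + h • v p.2))
  convert! this using 1
  funext ω
  rw [Fintype.sum_prod_type]
  refine Finset.sum_congr rfl fun i _ => ?_
  rw [laplacianField, hz, Finset.mul_sum, Finset.mul_sum]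
  exact Finset.sum_congr rfl fun j _ => by ring

theorem IsStationaryGRF.hasGaussianLaw_laplacianField (hZ : IsStationaryGRF P X W C)
    (m : ℕ) (h : ℝ) (k : Fin 2) (s : EuclideanSpace ℝ (Fin d)) :
    HasGaussianLaw (laplacianField X W m h k s) P := by
  have := hZ.hasGaussianLaw_linearCombination (ι := Fin 1) m h (fun _ => 1) (fun _ => k)
    (fun _ => s)
  simpa using this

theorem IsStationaryGRF.memLp (hZ : IsStationaryGRF P X W C) (k : Fin 2)
    (s : EuclideanSpace ℝ (Fin d)) : MemLp ((![X, W] : Fin 2 → _) k s) 2 P :=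
  (hZ.gaussian.hasGaussianLaw_eval (k, s)).memLp_two

/-- The covariance depends on s − t, so differencing in t is differencing in the lag with step −h.
The Laplacian is even in its step, so the `m` iterates in s and the `m` iterates in t combine into
2m. -/
theorem IsStationaryGRF.covariance_laplacianField (hZ : IsStationaryGRF P X W C)
    (m : ℕ) (h : ℝ) (k l : Fin 2) (s t : EuclideanSpace ℝ (Fin d)) :
    cov[laplacianField X W m h k s, laplacianField X W m h l t; P] =
      (discreteLaplacian h)^[2 * m] (C k l) (s - t) := by
  have := hZ.gaussian.isProbabilityMeasure
  obtain ⟨N, w, v, -, hz⟩ := exists_stencil d m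
  have e : ∀ k s, laplacianField X W m h k s =
      fun ω => ∑ i, ((1 / h ^ 2) ^ m * w i) * (![X, W] : Fin 2 → _) k (s + h • v i) ω := by
    intro k s
    funext ω
    rw [laplacianField, hz, Finset.mul_sum]
    exact Finset.sum_congr rfl fun j _ => by ring
  rw [e, e, covariance_fun_sum_fun_sum (fun i => (hZ.memLp k _).const_mul _)
    (fun i => (hZ.memLp l _).const_mul _)]
  have hc : ∀ i j, cov[fun ω => ((1 / h ^ 2) ^ m * w i) * (![X, W] : Fin 2 → _) k (s + h • v i) ω,
      fun ω => ((1 / h ^ 2) ^ m * w j) * (![X, W] : Fin 2 → _) l (t + h • v j) ω; P] =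
      ((1 / h ^ 2) ^ m * w i) * (((1 / h ^ 2) ^ m * w j) *
        C k l (s - t + (-h) • v j + h • v i)) := by
    intro i j
    have hshift : t + h • v j + (s - t + (-h) • v j + h • v i) = s + h • v i := by module
    rw [covariance_const_mul_left, covariance_const_mul_right, ← hZ.cov k l (t + h • v j), hshift]
  simp only [hc]
  rw [two_mul, Function.iterate_add_apply, ← discreteLaplacian_neg_step h, hz (-h),
    discreteLaplacian_neg_step h, Finset.sum_comm, Finset.mul_sum]
  refine Finset.sum_congr rfl fun j _ => ?_
  rw [hz, Finset.mul_sum, Finset.mul_sum, Finset.mul_sum]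
  refine Finset.sum_congr rfl fun i _ => ?_
  rw [neg_sq]
  ring

theorem discreteLaplacian_const (h c : ℝ) :
    discreteLaplacian (d := d) h (fun _ => c) = fun _ => 0 := by
  funext s
  simp only [discreteLaplacian]
  rw [Finset.sum_eq_zero fun g _ => by ring, mul_zero]

theorem iterate_discreteLaplacian_const {m : ℕ} (hm : 1 ≤ m) (h c : ℝ)
    (s : EuclideanSpace ℝ (Fin d)) : (discreteLaplacian h)^[m] (fun _ => c) s = 0 := by
  induction m, hm using Nat.le_induction generalizing c with
  | base => simp [discreteLaplacian_const]
  | succ m _ ih => rw [Function.iterate_succ_apply, discreteLaplacian_const, ih]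

theorem IsStationaryGRF.integral_laplacianField (hZ : IsStationaryGRF P X W C)
    {m : ℕ} (hm : 1 ≤ m) (h : ℝ) (k : Fin 2) (s : EuclideanSpace ℝ (Fin d)) :
    ∫ ω, laplacianField X W m h k s ω ∂P = 0 := by
  have := hZ.gaussian.isProbabilityMeasure
  obtain ⟨N, w, v, -, hz⟩ := exists_stencil d m
  obtain ⟨μ, hμ⟩ := hZ.mean k
  simp only [laplacianField, hz]
  rw [integral_const_mul, integral_finsetSum _ fun i _ =>
    ((hZ.memLp k _).integrable one_le_two).const_mul _]
  simp only [integral_const_mul, hμ]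
  have := iterate_discreteLaplacian_const (d := d) hm h μ s
  rwa [hz] at this

theorem IsStationaryGRF.integral_laplacianField_mul (hZ : IsStationaryGRF P X W C)
    {m : ℕ} (hm : 1 ≤ m) (h : ℝ) (k l : Fin 2) (s t : EuclideanSpace ℝ (Fin d)) :
    ∫ ω, laplacianField X W m h k s ω * laplacianField X W m h l t ω ∂P =
      (discreteLaplacian h)^[2 * m] (C k l) (s - t) := by
  rw [← hZ.covariance_laplacianField, covariance, hZ.integral_laplacianField hm,
    hZ.integral_laplacianField hm]
  simp

theorem IsStationaryGRF.memLp_laplacianField_mul (hZ : IsStationaryGRF P X W C)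
    (m : ℕ) (h : ℝ) (k l : Fin 2) (s t : EuclideanSpace ℝ (Fin d)) :
    MemLp (fun ω => laplacianField X W m h k s ω * laplacianField X W m h l t ω) 2 P := by
  have h1 := (hZ.hasGaussianLaw_laplacianField m h k s).memLp (p := 4) (by norm_num)
  have h2 := (hZ.hasGaussianLaw_laplacianField m h l t).memLp (p := 4) (by norm_num)
  have : ENNReal.HolderTriple 4 4 2 := ⟨by
    rw [← two_mul, show (4 : ENNReal) = 2 * 2 by norm_num, ENNReal.mul_inv (by simp) (by simp),
      ← mul_assoc, ENNReal.mul_inv_cancel (by simp) (by simp), one_mul]⟩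
  exact h2.mul h1

/-- Of the three pairings in Isserlis' formula, the one within each site is the product of means and
cancels. -/
theorem IsStationaryGRF.covariance_laplacianField_mul (hZ : IsStationaryGRF P X W C)
    {m : ℕ} (hm : 1 ≤ m) (h : ℝ) (k l : Fin 2) (s t : EuclideanSpace ℝ (Fin d)) :
    cov[fun ω => laplacianField X W m h k s ω * laplacianField X W m h l s ω,
      fun ω => laplacianField X W m h k t ω * laplacianField X W m h l t ω; P] =
      (discreteLaplacian h)^[2 * m] (C k k) (s - t) * (discreteLaplacian h)^[2 * m] (C l l) (s - t) +
      (discreteLaplacian h)^[2 * m] (C k l) (s - t) *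
        (discreteLaplacian h)^[2 * m] (C l k) (s - t) := by
  have := hZ.gaussian.isProbabilityMeasure
  rw [covariance_eq_sub (hZ.memLp_laplacianField_mul m h k l s s)
    (hZ.memLp_laplacianField_mul m h k l t t)]
  have key := integral_mul_mul_mul_of_gaussian (P := P)
    (X := fun i => laplacianField X W m h ((![k, l, k, l] : Fin 4 → Fin 2) i)
      ((![s, s, t, t] : Fin 4 → _) i))
    (fun a => hZ.hasGaussianLaw_linearCombination m h a _ _)
    (fun i => hZ.integral_laplacianField hm h _ _)
  simp only [Matrix.cons_val] at key
  simp only [Pi.mul_apply, key, hZ.integral_laplacianField_mul hm]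
  ring

/-- Nonnegativity of the variances of ξ + η and ξ − η, where ξ and η have equal variance by
stationarity. -/
theorem IsStationaryGRF.abs_iterate_discreteLaplacian_le (hZ : IsStationaryGRF P X W C)
    (m : ℕ) (h : ℝ) (k : Fin 2) (u : EuclideanSpace ℝ (Fin d)) :
    |(discreteLaplacian h)^[2 * m] (C k k) u| ≤ (discreteLaplacian h)^[2 * m] (C k k) 0 := by
  have := hZ.gaussian.isProbabilityMeasure
  set ξ := laplacianField X W m h k u with hξ
  set η := laplacianField X W m h k 0 with hη
  have h1 : MemLp ξ 2 P := (hZ.hasGaussianLaw_laplacianField m h k u).memLp_two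
  have h2 : MemLp η 2 P := (hZ.hasGaussianLaw_laplacianField m h k 0).memLp_two
  have e1 := hZ.covariance_laplacianField m h k k u 0
  have e2 := hZ.covariance_laplacianField m h k k u u
  have e3 := hZ.covariance_laplacianField m h k k 0 0
  rw [sub_zero] at e1
  rw [sub_self] at e2 e3
  rw [covariance_self h1.aemeasurable] at e2
  rw [covariance_self h2.aemeasurable] at e3
  have p1 := variance_add h1 h2
  have p2 := variance_sub h1 h2
  have n1 := variance_nonneg (ξ + η) P
  have n2 := variance_nonneg (ξ - η) P
  rw [← hξ, ← hη] at e1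
  rw [abs_le]
  constructor <;> linarith

end LaplacianField

/-! ### Variance of a sum through a partition into blocks. -/

section Blocks

variable {Ω ι κ : Type*} [MeasurableSpace Ω] {P : Measure Ω} [IsProbabilityMeasure P]

theorem variance_fun_sum_le_card_mul (s : Finset ι) {Y : ι → Ω → ℝ}
    (hY : ∀ i ∈ s, MemLp (Y i) 2 P) :
    Var[fun ω => ∑ i ∈ s, Y i ω; P] ≤ s.card * ∑ i ∈ s, Var[Y i; P] := by
  have hsum : MemLp (fun ω => ∑ i ∈ s, Y i ω) 2 P := memLp_finsetSum _ hY
  rw [variance_eq_integral hsum.aemeasurable, Finset.sum_congr rfl fun i hi =>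
    variance_eq_integral (hY i hi).aemeasurable, ← integral_finsetSum, ← integral_const_mul]
  · refine integral_mono (hsum.sub (memLp_const _)).integrable_sq ?_ fun ω => ?_
    · exact (integrable_finsetSum _ fun i hi =>
        ((hY i hi).sub (memLp_const _)).integrable_sq).const_mul _
    · simp only
      rw [integral_finsetSum _ fun i hi => (hY i hi).integrable one_le_two,
        ← Finset.sum_sub_distrib]
      exact sq_sum_le_card_mul_sum_sq
  · exact fun i hi => ((hY i hi).sub (memLp_const _)).integrable_sq

/-- The variance of a sum is controlled by the covariances inside the blocks of a partition. -/
theorem variance_fun_sum_le_of_blocks [DecidableEq κ] (s : Finset ι) (t : Finset κ) (b : ι → κ)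
    (hb : ∀ i ∈ s, b i ∈ t) {Y : ι → Ω → ℝ} (hY : ∀ i ∈ s, MemLp (Y i) 2 P) {F : ι → ι → ℝ}
    (hF0 : ∀ i j, 0 ≤ F i j) (hF : ∀ i ∈ s, ∀ j ∈ s, b i = b j → |cov[Y i, Y j; P]| ≤ F i j) :
    Var[fun ω => ∑ i ∈ s, Y i ω; P] ≤ t.card * ∑ i ∈ s, ∑ j ∈ s, F i j := by
  classical
  have h1 : (fun ω => ∑ i ∈ s, Y i ω) = fun ω => ∑ k ∈ t, ∑ i ∈ s with b i = k, Y i ω := by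
    funext ω
    exact (Finset.sum_fiberwise_of_maps_to hb _).symm
  have hY' : ∀ k, ∀ i ∈ s.filter (b · = k), MemLp (Y i) 2 P := fun k i hi =>
    hY i (Finset.mem_filter.1 hi).1
  rw [h1]
  refine (variance_fun_sum_le_card_mul t fun k _ => memLp_finsetSum _ (hY' k)).trans ?_
  refine mul_le_mul_of_nonneg_left ?_ (Nat.cast_nonneg _)
  rw [← Finset.sum_fiberwise_of_maps_to hb]
  refine Finset.sum_le_sum fun k _ => ?_
  have hmem : MemLp (fun ω => ∑ i ∈ s with b i = k, Y i ω) 2 P := memLp_finsetSum _ (hY' k)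
  rw [← covariance_self hmem.aemeasurable, covariance_fun_sum_fun_sum' (hY' k) (hY' k)]
  refine Finset.sum_le_sum fun i hi => ?_
  rw [Finset.mem_filter] at hi
  calc ∑ j ∈ s with b j = k, cov[Y i, Y j; P] ≤ ∑ j ∈ s with b j = k, F i j := by
        refine Finset.sum_le_sum fun j hj => ?_
        rw [Finset.mem_filter] at hj
        exact (le_abs_self _).trans (hF i hi.1 j hj.1 (hi.2.trans hj.2.symm))
    _ ≤ ∑ j ∈ s, F i j :=
        Finset.sum_le_sum_of_subset_of_nonneg (Finset.filter_subset _ _) fun _ _ _ => hF0 _ _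

end Blocks

/-! ### Chebyshev's inequality and ratios. -/

section ConvergenceInProbability

variable {Ω : Type*} [MeasurableSpace Ω] {P : Measure Ω}

theorem tendstoInMeasure_of_tendsto_integral_of_tendsto_variance [IsProbabilityMeasure P]
    {U : ℕ → Ω → ℝ} {c : ℝ}
    (hU : ∀ n, MemLp (U n) 2 P) (hmean : Tendsto (fun n => ∫ ω, U n ω ∂P) atTop (𝓝 c))
    (hvar : Tendsto (fun n => Var[U n; P]) atTop (𝓝 0)) :
    TendstoInMeasure P U atTop (fun _ => c) := by
  rw [tendstoInMeasure_iff_dist]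
  intro ε hε
  have h1 : Tendsto (fun n => ENNReal.ofReal (Var[U n; P] / (ε / 2) ^ 2)) atTop (𝓝 0) := by
    have := ENNReal.tendsto_ofReal (hvar.div_const ((ε / 2) ^ 2))
    simpa using this
  refine tendsto_of_tendsto_of_tendsto_of_le_of_le' tendsto_const_nhds h1
    (Eventually.of_forall fun _ => zero_le) ?_
  filter_upwards [Metric.tendsto_nhds.1 hmean (ε / 2) (half_pos hε)] with n hn
  refine (measure_mono fun ω hω => ?_).trans (meas_ge_le_variance_div_sq (hU n) (half_pos hε))
  have hω' : ε ≤ dist (U n ω) c := hω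
  rw [Real.dist_eq] at hn hω'
  show ε / 2 ≤ |U n ω - ∫ ω, U n ω ∂P|
  have := abs_sub_le (U n ω) (∫ ω, U n ω ∂P) c
  linarith

/-- If the denominators converge in probability to a positive constant and the errors to `0`, then
the ratios converge. -/
theorem tendstoInMeasure_div_of_pos {N D E : ℕ → Ω → ℝ} {κ β : ℝ} (hκ : 0 < κ)
    (hD : TendstoInMeasure P D atTop (fun _ => κ)) (hE : TendstoInMeasure P E atTop (fun _ => 0))
    (hN : ∀ n ω, N n ω = D n ω * β + E n ω) :
    TendstoInMeasure P (fun n ω => N n ω / D n ω) atTop (fun _ => β) := by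
  rw [tendstoInMeasure_iff_dist] at hD hE ⊢
  intro ε hε
  have h1 := (hD (κ / 2) (half_pos hκ)).add (hE (ε * (κ / 2)) (by positivity))
  rw [add_zero] at h1
  refine tendsto_of_tendsto_of_tendsto_of_le_of_le tendsto_const_nhds h1
    (fun _ => zero_le) fun n => ?_
  refine (measure_mono fun ω hω => ?_).trans (measure_union_le _ _)
  by_contra hcon
  simp only [mem_union, Set.mem_ofPred_eq, not_or, not_le, Real.dist_eq, sub_zero] at hcon hω
  obtain ⟨hd, he⟩ := hcon
  have hDpos : κ / 2 < D n ω := by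
    have := (abs_lt.1 hd).1
    linarith
  have hD0 : 0 < D n ω := by linarith
  rw [hN, add_div, mul_div_cancel_left₀ _ hD0.ne', add_sub_cancel_left, abs_div, abs_of_pos hD0,
    le_div_iff₀ hD0] at hω
  nlinarith

end ConvergenceInProbability

/-! ### Sums of negative powers of distances over the grid. -/

section LatticeSums

theorem sum_range_one_add_rpow_neg_le {θ : ℝ} (h0 : 0 ≤ θ) (h1 : θ < 1) (n : ℕ) :
    ∑ i ∈ Finset.range n, (1 + (i : ℝ)) ^ (-θ) ≤ (n : ℝ) ^ (1 - θ) / (1 - θ) := by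
  have hθ : 0 < 1 - θ := by linarith
  induction n with
  | zero => simp [Real.zero_rpow hθ.ne']
  | succ n ih =>
    rw [Finset.sum_range_succ]
    refine (add_le_add_left ih _).trans ?_
    rw [div_add' _ _ _ hθ.ne', div_le_div_iff_of_pos_right hθ]
    push_cast
    have hx : (0 : ℝ) < n + 1 := by positivity
    -- Bernoulli's inequality for the exponent 1 − θ in [0, 1]: n^(1−θ) + (1−θ)(n+1)^(−θ) ≤
    -- (n+1)^(1−θ), which is the induction step.
    have hb := rpow_one_add_le_one_add_mul_self (s := -1 / (n + 1 : ℝ)) (by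
      rw [le_div_iff₀ hx]; linarith [(Nat.cast_nonneg n : (0 : ℝ) ≤ n)]) hθ.le (by linarith)
    have e1 : (1 + -1 / (n + 1 : ℝ)) = n / (n + 1) := by field_simp; ring
    rw [e1, Real.div_rpow (Nat.cast_nonneg n) hx.le, div_le_iff₀ (by positivity)] at hb
    refine (add_le_add_left hb _).trans (le_of_eq ?_)
    rw [add_comm (1 : ℝ) (n : ℝ), Real.rpow_sub hx, Real.rpow_neg hx.le, Real.rpow_one]
    have := (Real.rpow_pos_of_pos hx θ).ne'
    field_simp
    ring

theorem sum_range_one_add_abs_sub_rpow_neg_le {θ : ℝ} (h0 : 0 ≤ θ) (h1 : θ < 1) {n a : ℕ}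
    (ha : a ≤ n) :
    ∑ b ∈ Finset.range (n + 1), (1 + |(a : ℝ) - b|) ^ (-θ) ≤
      2 / (1 - θ) * ((n : ℝ) + 1) ^ (1 - θ) := by
  set f : ℕ → ℝ := fun i => (1 + (i : ℝ)) ^ (-θ) with hf
  have hf0 : ∀ i, 0 ≤ f i := fun i => by positivity
  have hS := sum_range_one_add_rpow_neg_le h0 h1 (n + 1)
  rw [← Finset.sum_range_add_sum_Ico _ (Nat.succ_le_succ ha)]
  have hA : ∑ b ∈ Finset.range (a + 1), (1 + |(a : ℝ) - b|) ^ (-θ) ≤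
      ∑ i ∈ Finset.range (n + 1), f i := by
    have e : ∑ b ∈ Finset.range (a + 1), (1 + |(a : ℝ) - b|) ^ (-θ) =
        ∑ b ∈ Finset.range (a + 1), f (a + 1 - 1 - b) := by
      refine Finset.sum_congr rfl fun b hb => ?_
      have hb' : b ≤ a := Nat.lt_succ_iff.1 (Finset.mem_range.1 hb)
      simp only [hf, add_tsub_cancel_right]
      rw [Nat.cast_sub hb', abs_of_nonneg (sub_nonneg.2 (by exact_mod_cast hb'))]
    rw [e, Finset.sum_range_reflect]
    exact Finset.sum_le_sum_of_subset_of_nonneg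
      (Finset.range_subset_range.2 (Nat.succ_le_succ ha)) fun _ _ _ => hf0 _
  have hB : ∑ b ∈ Finset.Ico (a + 1) (n + 1), (1 + |(a : ℝ) - b|) ^ (-θ) ≤
      ∑ i ∈ Finset.range (n + 1), f i := by
    rw [Finset.sum_Ico_eq_sum_range]
    calc _ ≤ ∑ i ∈ Finset.range (n + 1 - (a + 1)), f i := by
          refine Finset.sum_le_sum fun i _ => ?_
          refine Real.rpow_le_rpow_of_nonpos (by positivity) ?_ (by linarith)
          push_cast
          rw [abs_sub_comm, show (a + 1 + i - a : ℝ) = 1 + i by ring, abs_of_nonneg (by positivity)]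
          linarith
      _ ≤ _ := Finset.sum_le_sum_of_subset_of_nonneg
          (Finset.range_subset_range.2 (Nat.sub_le _ _)) fun _ _ _ => hf0 _
  calc _ ≤ ((n + 1 : ℕ) : ℝ) ^ (1 - θ) / (1 - θ) + ((n + 1 : ℕ) : ℝ) ^ (1 - θ) / (1 - θ) :=
        add_le_add (hA.trans hS) (hB.trans hS)
    _ = _ := by push_cast; ring

variable {d : ℕ}

theorem card_gridInterior (d n m : ℕ) : (gridInterior d n m).card = (n - m + 1 - m) ^ d := by
  simp [gridInterior, Fintype.card_piFinset]

theorem mem_gridInterior {n m : ℕ} {j : Fin d → ℕ} :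
    j ∈ gridInterior d n m ↔ ∀ g, m ≤ j g ∧ j g ≤ n - m := by
  simp [gridInterior, Fintype.mem_piFinset]

theorem sum_gridInterior_prod_le {θ : ℝ} (h0 : 0 ≤ θ) (h1 : θ < 1) {n m : ℕ} {i : Fin d → ℕ}
    (hi : i ∈ gridInterior d n m) :
    ∑ j ∈ gridInterior d n m, ∏ g, (1 + |(i g : ℝ) - j g|) ^ (-θ) ≤
      (2 / (1 - θ) * ((n : ℝ) + 1) ^ (1 - θ)) ^ d := by
  have e := (Finset.prod_univ_sum (fun _ : Fin d => Finset.Icc m (n - m))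
    (fun g b => (1 + |(i g : ℝ) - b|) ^ (-θ))).symm
  rw [gridInterior, e]
  calc _ ≤ ∏ _g : Fin d, (2 / (1 - θ) * ((n : ℝ) + 1) ^ (1 - θ)) := by
        refine Finset.prod_le_prod (fun g _ => Finset.sum_nonneg fun b _ => by positivity)
          fun g _ => ?_
        have hig : i g ≤ n := ((mem_gridInterior.1 hi g).2).trans (Nat.sub_le _ _)
        refine (Finset.sum_le_sum_of_subset_of_nonneg (fun b hb => ?_) fun _ _ _ =>
          by positivity).trans (sum_range_one_add_abs_sub_rpow_neg_le h0 h1 hig)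
        rw [Finset.mem_Icc] at hb
        exact Finset.mem_range.2 (by omega)
    _ = _ := by simp

theorem gridPoint_sub_apply (h : ℝ) (i j : Fin d → ℕ) (g : Fin d) :
    (gridPoint h i - gridPoint h j) g = h * ((i g : ℝ) - j g) := by
  simp [gridPoint, mul_sub]

/-- The rescaled distance dominates 1 plus each coordinate difference, so splitting the exponent s
equally among the coordinates bounds the power by a product, whose sum over the grid factorizes.
Lowering σ to s is harmless because the rescaled distance is at least 1. -/
theorem rpow_neg_add_norm_gridPoint_sub_le (hd : 1 ≤ d) {h σ s : ℝ} (hh : 0 < h) (hs0 : 0 ≤ s)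
    (hsσ : s ≤ σ) (i j : Fin d → ℕ) :
    (h + ‖gridPoint h i - gridPoint h j‖) ^ (-σ) ≤
      h ^ (-σ) * ∏ g, (1 + |(i g : ℝ) - j g|) ^ (-(s / d)) := by
  have hd0 : (0 : ℝ) < d := by exact_mod_cast hd
  set y : ℝ := (h + ‖gridPoint h i - gridPoint h j‖) / h with hy
  have hyg : ∀ g, 1 + |(i g : ℝ) - j g| ≤ y := by
    intro g
    rw [hy, le_div_iff₀ hh]
    have := PiLp.norm_apply_le (gridPoint h i - gridPoint h j) g
    rw [gridPoint_sub_apply, Real.norm_eq_abs, abs_mul, abs_of_pos hh] at this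
    linarith
  have hy1 : 1 ≤ y := le_trans (by linarith [abs_nonneg ((i ⟨0, hd⟩ : ℝ) - j ⟨0, hd⟩)])
    (hyg ⟨0, hd⟩)
  have hy0 : 0 < y := by linarith
  have e : h + ‖gridPoint h i - gridPoint h j‖ = h * y := by rw [hy]; field_simp
  rw [e, Real.mul_rpow hh.le hy0.le]
  refine mul_le_mul_of_nonneg_left ?_ (Real.rpow_nonneg hh.le _)
  calc y ^ (-σ) ≤ y ^ (-s) := Real.rpow_le_rpow_of_exponent_le hy1 (by linarith)
    _ = ∏ _g : Fin d, y ^ (-(s / d)) := by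
        rw [Finset.prod_const, Finset.card_univ, Fintype.card_fin, ← Real.rpow_natCast,
          ← Real.rpow_mul hy0.le]
        congr 1
        field_simp
    _ ≤ _ := Finset.prod_le_prod (fun _ _ => by positivity) fun g _ =>
        Real.rpow_le_rpow_of_nonpos (by positivity) (hyg g) (by
          rw [neg_nonpos]; positivity)

theorem tendsto_step (L : ℝ) (hL : 0 < L) :
    Tendsto (fun n : ℕ => L / (n : ℝ)) atTop (𝓝[>] 0) := by
  refine tendsto_nhdsWithin_iff.2 ⟨tendsto_const_div_atTop_nhds_zero_nat L, ?_⟩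
  filter_upwards [eventually_gt_atTop 0] with n hn
  exact div_pos hL (by exact_mod_cast hn)

theorem tendsto_step_rpow {L e : ℝ} (hL : 0 < L) (he : 0 < e) :
    Tendsto (fun n : ℕ => (L / (n : ℝ)) ^ e) atTop (𝓝 0) := by
  have h := (Real.continuousAt_rpow_const 0 e (Or.inr he.le)).tendsto
  rw [Real.zero_rpow he.ne'] at h
  exact h.comp ((tendsto_step L hL).mono_right nhdsWithin_le_nhds)

/-- Normalised double sums of a negative power of the distance over the grid tend to `0`. -/
theorem tendsto_sum_sum_rpow_neg (hd : 1 ≤ d) {L : ℝ} (hL : 0 < L) (m : ℕ) {ρ σ : ℝ} (hρ : 0 < ρ)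
    (hσ0 : 0 ≤ σ) (hσ : σ < 2 * ρ + d) :
    Tendsto (fun n : ℕ => (L / n) ^ (2 * ρ) / ((gridInterior d n m).card : ℝ) ^ 2 *
      ∑ i ∈ gridInterior d n m, ∑ j ∈ gridInterior d n m,
        (L / n + ‖gridPoint (L / n) i - gridPoint (L / n) j‖) ^ (-σ)) atTop (𝓝 0) := by
  have hd0 : (0 : ℝ) < d := by exact_mod_cast hd
  -- The one-dimensional sums need s < d, while the final power of h needs s > σ − 2ρ. For σ ≥ d the
  -- midpoint of σ − 2ρ and d, truncated at 0, meets both.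
  obtain ⟨s, hs0, hsσ, hsd, hs⟩ : ∃ s : ℝ, 0 ≤ s ∧ s ≤ σ ∧ s < d ∧ 0 < 2 * ρ - σ + s := by
    rcases lt_or_ge σ d with h | h
    · exact ⟨σ, hσ0, le_rfl, h, by linarith⟩
    · refine ⟨max 0 ((σ - 2 * ρ + d) / 2), le_max_left _ _, max_le hσ0 (by linarith),
        max_lt hd0 (by linarith), ?_⟩
      have := le_max_right 0 ((σ - 2 * ρ + d) / 2)
      linarith
  set θ : ℝ := s / d with hθ
  have hθ0 : 0 ≤ θ := by positivity
  have hθ1 : θ < 1 := (div_lt_one hd0).2 hsd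
  set K : ℝ := (2 / (1 - θ) * 2) ^ d * L ^ (-s) with hK
  have hlim : Tendsto (fun n : ℕ => K * (L / (n : ℝ)) ^ (2 * ρ - σ + s)) atTop (𝓝 0) := by
    simpa using (tendsto_step_rpow hL hs).const_mul K
  refine tendsto_of_tendsto_of_tendsto_of_le_of_le' tendsto_const_nhds hlim
    (Eventually.of_forall fun n => by positivity) ?_
  -- Then each side keeps n + 1 − 2m ≥ (n + 1)/2 of its points.
  filter_upwards [eventually_ge_atTop (4 * m + 1)] with n hn
  have hn0 : (0 : ℝ) < n := by exact_mod_cast (by omega : 0 < n)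
  set h : ℝ := L / n with hh
  have hh0 : 0 < h := div_pos hL hn0
  set G := gridInterior d n m with hG
  have hcard : (((n : ℝ) + 1) / 2) ^ d ≤ G.card := by
    rw [hG, card_gridInterior]
    push_cast
    refine pow_le_pow_left₀ (by positivity) ?_ d
    have e1 : n - m + 1 - m = n + 1 - 2 * m := by omega
    rw [e1, Nat.cast_sub (by omega)]
    have : (4 * m + 1 : ℝ) ≤ n := by exact_mod_cast hn
    push_cast
    linarith
  have hGpos : (0 : ℝ) < G.card := lt_of_lt_of_le (by positivity) hcard
  have hsum : ∑ i ∈ G, ∑ j ∈ G, (h + ‖gridPoint h i - gridPoint h j‖) ^ (-σ) ≤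
      G.card * (h ^ (-σ) * (2 / (1 - θ) * ((n : ℝ) + 1) ^ (1 - θ)) ^ d) := by
    rw [← nsmul_eq_mul]
    refine Finset.sum_le_card_nsmul _ _ _ fun i hi => ?_
    refine (Finset.sum_le_sum fun j _ =>
      rpow_neg_add_norm_gridPoint_sub_le hd hh0 hs0 hsσ i j).trans ?_
    rw [← Finset.mul_sum]
    exact mul_le_mul_of_nonneg_left (sum_gridInterior_prod_le hθ0 hθ1 hi)
      (Real.rpow_nonneg hh0.le _)
  have hθ' : 0 < 1 - θ := by linarith
  have hbox : (2 / (1 - θ) * ((n : ℝ) + 1) ^ (1 - θ)) ^ d ≤ G.card * (K * h ^ s) := by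
    have hn1 : (0 : ℝ) < n + 1 := by positivity
    have e2 : (2 / (1 - θ) * ((n : ℝ) + 1) ^ (1 - θ)) ^ d =
        (((n : ℝ) + 1) / 2) ^ d * ((2 / (1 - θ) * 2) ^ d * ((n : ℝ) + 1) ^ (-s)) := by
      have e3 : ((n : ℝ) + 1) ^ (-s) = (((n : ℝ) + 1) ^ (-θ)) ^ d := by
        rw [← Real.rpow_natCast, ← Real.rpow_mul hn1.le, hθ]
        congr 1
        field_simp
      rw [e3, ← mul_pow, ← mul_pow, sub_eq_add_neg, Real.rpow_add hn1, Real.rpow_one]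
      congr 1
      ring
    rw [e2]
    refine mul_le_mul hcard ?_ (by positivity) hGpos.le
    rw [hK, mul_assoc]
    refine mul_le_mul_of_nonneg_left ?_ (by positivity)
    rw [Real.rpow_neg hL.le, inv_mul_eq_div, ← Real.div_rpow hh0.le hL.le, Real.rpow_neg hn1.le,
      ← Real.inv_rpow hn1.le]
    refine Real.rpow_le_rpow (by positivity) ?_ hs0
    rw [hh, div_right_comm, div_self hL.ne', one_div]
    exact inv_anti₀ hn0 (by linarith)
  calc h ^ (2 * ρ) / (G.card : ℝ) ^ 2 *
      ∑ i ∈ G, ∑ j ∈ G, (h + ‖gridPoint h i - gridPoint h j‖) ^ (-σ)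
      ≤ h ^ (2 * ρ) / (G.card : ℝ) ^ 2 * (G.card * (h ^ (-σ) * (G.card * (K * h ^ s)))) := by
        refine mul_le_mul_of_nonneg_left (hsum.trans ?_) (by positivity)
        gcongr
    _ = K * h ^ (2 * ρ - σ + s) := by
        rw [sub_eq_add_neg, Real.rpow_add hh0, Real.rpow_add hh0]
        field_simp

end LatticeSums

/-! ### Partition of the grid into small cubes. -/

section GridBlocks

variable {d : ℕ}

/-- The index of the block of side `1 / N` of the grid that contains the point of index `j`. -/
def blockIndex (n N : ℕ) (j : Fin d → ℕ) : Fin d → ℕ := fun g => j g * N / n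

theorem blockIndex_mem {n N m : ℕ} {j : Fin d → ℕ} (hj : j ∈ gridInterior d n m) :
    blockIndex n N j ∈ Fintype.piFinset fun _ : Fin d => Finset.range (N + 1) := by
  rw [Fintype.mem_piFinset]
  intro g
  rw [Finset.mem_range, Nat.lt_succ_iff, blockIndex]
  have : j g ≤ n := ((mem_gridInterior.1 hj g).2).trans (Nat.sub_le _ _)
  exact Nat.div_le_of_le_mul (Nat.mul_le_mul_right N this)

theorem norm_gridPoint_sub_le_of_blockIndex_eq {n N : ℕ} (hn : 0 < n) (hN : 0 < N) {L : ℝ}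
    (hL : 0 < L) {i j : Fin d → ℕ} (hij : blockIndex n N i = blockIndex n N j) :
    ‖gridPoint (L / n) i - gridPoint (L / n) j‖ ≤ d * (L / N) := by
  have hn0 : (0 : ℝ) < n := by exact_mod_cast hn
  have hN0 : (0 : ℝ) < N := by exact_mod_cast hN
  have key : ∀ (i j : Fin d → ℕ), blockIndex n N i = blockIndex n N j → ∀ g,
      ((i g : ℝ) - j g) * N ≤ n := by
    intro i j hij g
    have h1 := congrFun hij g
    simp only [blockIndex] at h1
    have h2 : i g * N < n * (i g * N / n) + n := Nat.lt_mul_div_succ _ hn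
    have h3 : n * (j g * N / n) ≤ j g * N := Nat.mul_div_le _ _
    rw [← h1] at h3
    have h4 : i g * N ≤ j g * N + n := by omega
    have : (i g : ℝ) * N ≤ j g * N + n := by exact_mod_cast h4
    linarith
  have hg : ∀ g, |(gridPoint (L / n) i - gridPoint (L / n) j) g| ≤ L / N := by
    intro g
    rw [gridPoint_sub_apply, abs_mul, abs_of_pos (div_pos hL hn0)]
    have h1 := key i j hij g
    have h2 := key j i hij.symm g
    have h3 : |(i g : ℝ) - j g| ≤ n / N := by
      rw [abs_le, le_div_iff₀ hN0, neg_le, le_div_iff₀ hN0]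
      constructor <;> linarith
    calc L / n * |(i g : ℝ) - j g| ≤ L / n * (n / N) := by gcongr
      _ = L / N := by field_simp
  set u := gridPoint (L / n) i - gridPoint (L / n) j with hu
  have hsum : u = ∑ g, u g • (EuclideanSpace.single g (1 : ℝ) : EuclideanSpace ℝ (Fin d)) := by
    ext g
    simp [Pi.single_apply]
  rw [hsum]
  refine (norm_sum_le _ _).trans ?_
  calc ∑ g, ‖u g • (EuclideanSpace.single g (1 : ℝ) : EuclideanSpace ℝ (Fin d))‖
      ≤ ∑ _g : Fin d, L / N := Finset.sum_le_sum fun g _ => by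
        rw [norm_smul_single]; exact hg g
    _ = d * (L / N) := by simp

end GridBlocks

/-! ### Consistency of the least squares coefficient. -/

section Consistency

variable {d : ℕ} {Ω : Type*} [MeasurableSpace Ω] {P : Measure Ω}
  {X W : EuclideanSpace ℝ (Fin d) → Ω → ℝ} {C : Fin 2 → Fin 2 → EuclideanSpace ℝ (Fin d) → ℝ}

theorem card_gridInterior_pos {n m : ℕ} (hn : 2 * m ≤ n) : 0 < (gridInterior d n m).card := by
  rw [card_gridInterior]
  exact Nat.pow_pos (by omega)

/-- The variance of the normalised sums of products of Laplacians tends to `0`. -/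
theorem IsStationaryGRF.tendsto_variance_normalized_sum (hZ : IsStationaryGRF P X W C)
    (hd : 1 ≤ d) {L : ℝ} (hL : 0 < L) {m : ℕ} (hm : 1 ≤ m) (l : Fin 2) (hCl : C l 0 = C 0 l)
    {ρ ρ₁ ρ₂ δ D : ℝ} (hρ : 0 < ρ) (hρ₁ : 0 ≤ ρ₁) (hρ₂ : 0 ≤ ρ₂) (hδ : 0 < δ) (hD : 0 ≤ D)
    (hρ₁ρ : ρ₁ < ρ + d) (hρ₂ρ : ρ₂ ≤ ρ)
    (h00 : ∀ h u, 0 < h → h < δ → ‖u‖ < δ →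
      |(discreteLaplacian h)^[2 * m] (C 0 0) u| ≤ D * (h + ‖u‖) ^ (-ρ))
    (hll : ∀ h u, 0 < h → h < δ → ‖u‖ < δ →
      |(discreteLaplacian h)^[2 * m] (C l l) u| ≤ D * (h + ‖u‖) ^ (-ρ₁))
    (h0l : ∀ h u, 0 < h → h < δ → ‖u‖ < δ →
      |(discreteLaplacian h)^[2 * m] (C 0 l) u| ≤ D * (h + ‖u‖) ^ (-ρ₂)) :
    Tendsto (fun n : ℕ => Var[fun ω => (L / n) ^ ρ / ((gridInterior d n m).card : ℝ) *
      ∑ j ∈ gridInterior d n m, laplacianField X W m (L / n) 0 (gridPoint (L / n) j) ω *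
        laplacianField X W m (L / n) l (gridPoint (L / n) j) ω; P]) atTop (𝓝 0) := by
  have := hZ.gaussian.isProbabilityMeasure
  have hd0 : (0 : ℝ) < d := by exact_mod_cast hd
  -- N does not depend on n: blocks of side L/N have diameter below δ, so the small-lag bounds hold
  -- within each, and their number stays at most (N + 1)^d.
  obtain ⟨N, hN⟩ := exists_nat_gt (d * L / δ)
  have hN0 : (0 : ℝ) < N := lt_of_le_of_lt (by positivity) hN
  have hN0' : 0 < N := by exact_mod_cast hN0
  have hNδ : d * (L / N) < δ := by
    rw [div_lt_iff₀ hδ] at hN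
    rw [← mul_div_assoc, div_lt_iff₀ hN0]
    linarith
  set Q := (Fintype.piFinset fun _ : Fin d => Finset.range (N + 1)) with hQ
  have hlim1 := tendsto_sum_sum_rpow_neg hd hL m (σ := ρ + ρ₁) hρ (by linarith) (by linarith)
  have hlim2 := tendsto_sum_sum_rpow_neg hd hL m (σ := ρ₂ + ρ₂) hρ (by linarith) (by linarith)
  have hlim := (hlim1.add hlim2).const_mul (Q.card * D ^ 2)
  rw [add_zero, mul_zero] at hlim
  refine tendsto_of_tendsto_of_tendsto_of_le_of_le' tendsto_const_nhds hlim
    (Eventually.of_forall fun n => variance_nonneg _ _) ?_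
  have hstep := (tendsto_step L hL).eventually (Ioo_mem_nhdsGT hδ)
  filter_upwards [hstep, eventually_gt_atTop 0] with n hn hn0
  set h := L / (n : ℝ) with hh
  set G := gridInterior d n m with hG
  set r : (Fin d → ℕ) → (Fin d → ℕ) → ℝ := fun i j => h + ‖gridPoint h i - gridPoint h j‖ with hr
  have hr0 : ∀ i j, 0 < r i j := fun i j => add_pos_of_pos_of_nonneg hn.1 (norm_nonneg _)
  have hblock := variance_fun_sum_le_of_blocks (P := P) G Q (blockIndex n N)
    (fun i hi => blockIndex_mem hi)
    (Y := fun j ω => laplacianField X W m h 0 (gridPoint h j) ω *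
      laplacianField X W m h l (gridPoint h j) ω)
    (fun i _ => hZ.memLp_laplacianField_mul m h 0 l _ _)
    (F := fun i j => D ^ 2 * (r i j ^ (-(ρ + ρ₁)) + r i j ^ (-(ρ₂ + ρ₂))))
    (fun i j => mul_nonneg (sq_nonneg D) (add_nonneg (Real.rpow_nonneg (hr0 i j).le _)
      (Real.rpow_nonneg (hr0 i j).le _)))
    (fun i _ j _ hij => by
      rw [hZ.covariance_laplacianField_mul hm, hCl]
      have hu : ‖gridPoint h i - gridPoint h j‖ < δ :=
        (norm_gridPoint_sub_le_of_blockIndex_eq hn0 hN0' hL hij).trans_lt hNδ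
      have b1 := h00 h _ hn.1 hn.2 hu
      have b2 := hll h _ hn.1 hn.2 hu
      have b3 := h0l h _ hn.1 hn.2 hu
      refine (abs_add_le _ _).trans ?_
      rw [abs_mul, abs_mul, mul_add, neg_add, neg_add, Real.rpow_add (hr0 i j),
        Real.rpow_add (hr0 i j)]
      have hp1 : 0 ≤ D * r i j ^ (-ρ) := mul_nonneg hD (Real.rpow_nonneg (hr0 i j).le _)
      have hp2 : 0 ≤ D * r i j ^ (-ρ₂) := mul_nonneg hD (Real.rpow_nonneg (hr0 i j).le _)
      refine add_le_add ((mul_le_mul b1 b2 (abs_nonneg _) hp1).trans (le_of_eq ?_))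
        ((mul_le_mul b3 b3 (abs_nonneg _) hp2).trans (le_of_eq ?_)) <;>
      · simp only [hr]; ring)
  rw [variance_const_mul]
  refine (mul_le_mul_of_nonneg_left hblock (sq_nonneg _)).trans (le_of_eq ?_)
  simp only [mul_add (D ^ 2), Finset.sum_add_distrib, ← Finset.mul_sum]
  have hpow : h ^ (2 * ρ) = (h ^ ρ) ^ 2 := by
    rw [mul_comm, Real.rpow_mul hn.1.le]
    norm_cast
  rw [hpow, div_pow]
  ring

theorem IsStationaryGRF.tendstoInMeasure_normalized_sum (hZ : IsStationaryGRF P X W C)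
    {L : ℝ} (hL : 0 < L) {m : ℕ} (hm : 1 ≤ m) (l : Fin 2) {ρ κ : ℝ}
    (hmean : Tendsto (fun h : ℝ => h ^ ρ * (discreteLaplacian h)^[2 * m] (C 0 l) 0) (𝓝[>] 0) (𝓝 κ))
    (hvar : Tendsto (fun n : ℕ => Var[fun ω => (L / n) ^ ρ / ((gridInterior d n m).card : ℝ) *
      ∑ j ∈ gridInterior d n m, laplacianField X W m (L / n) 0 (gridPoint (L / n) j) ω *
        laplacianField X W m (L / n) l (gridPoint (L / n) j) ω; P]) atTop (𝓝 0)) :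
    TendstoInMeasure P (fun (n : ℕ) ω => (L / n) ^ ρ / ((gridInterior d n m).card : ℝ) *
      ∑ j ∈ gridInterior d n m, laplacianField X W m (L / n) 0 (gridPoint (L / n) j) ω *
        laplacianField X W m (L / n) l (gridPoint (L / n) j) ω) atTop (fun _ => κ) := by
  have := hZ.gaussian.isProbabilityMeasure
  have hL2 : ∀ (n : ℕ) (j : Fin d → ℕ), MemLp (fun ω =>
      laplacianField X W m (L / n) 0 (gridPoint (L / n) j) ω *
        laplacianField X W m (L / n) l (gridPoint (L / n) j) ω) 2 P := fun n j =>
    hZ.memLp_laplacianField_mul m _ 0 l _ _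
  refine tendstoInMeasure_of_tendsto_integral_of_tendsto_variance
    (fun n => (memLp_finsetSum _ fun j _ => hL2 n j).const_mul _) ?_ hvar
  refine (hmean.comp (tendsto_step L hL)).congr' ?_
  filter_upwards [eventually_ge_atTop (2 * m)] with n hn
  rw [integral_const_mul, integral_finsetSum _ fun j _ => (hL2 n j).integrable one_le_two]
  simp only [hZ.integral_laplacianField_mul hm, sub_self, Finset.sum_const, nsmul_eq_mul]
  have : ((gridInterior d n m).card : ℝ) ≠ 0 := by
    exact_mod_cast (card_gridInterior_pos hn).ne'
  simp only [Function.comp]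
  field_simp

/-- The scaling limit of the variance of the Laplacian of `X` is positive. -/
theorem IsStationaryGRF.exists_tendsto_variance_pos (hZ : IsStationaryGRF P X W C) (hd : 1 ≤ d)
    {m : ℕ} {α c : ℝ} (hα : 0 < α) (heven : ∀ i : ℕ, α ≠ 2 * (i : ℝ)) (hc : c ≠ 0)
    (hαm : α < 4 * m) (hf : HasLocalExpansion (C 0 0) α c (2 * (2 * m))) :
    ∃ κ > 0, Tendsto (fun h : ℝ => h ^ (4 * m - α) * (discreteLaplacian h)^[2 * m] (C 0 0) 0)
      (𝓝[>] 0) (𝓝 κ) := by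
  have hcast : (2 * ((2 * m : ℕ) : ℝ) - α) = 4 * m - α := by push_cast; ring
  have hlim : ∀ u : EuclideanSpace ℝ (Fin d), Tendsto (fun h : ℝ => h ^ (4 * m - α) *
      (discreteLaplacian h)^[2 * m] (C 0 0) (h • u)) (𝓝[>] 0)
      (𝓝 (c * (discreteLaplacian 1)^[2 * m] (fun x => ‖x‖ ^ α) u)) := by
    intro u
    have := hf.tendsto_iterate_discreteLaplacian (by push_cast; linarith) u
    rwa [hcast] at this
  obtain ⟨u, hu⟩ := exists_iterate_discreteLaplacian_norm_rpow_ne_zero hd hα heven (2 * m)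
  have h0 := hlim 0
  simp only [smul_zero] at h0
  refine ⟨_, ?_, h0⟩
  -- Domination of covariances by the variance passes to the limit, so κ is at least the absolute
  -- value of the limit at a u where it does not vanish.
  have hle := le_of_tendsto_of_tendsto (hlim u).abs h0 (by
    filter_upwards [self_mem_nhdsWithin] with h hh
    have hh0 : (0 : ℝ) < h := hh
    rw [abs_mul, abs_of_pos (Real.rpow_pos_of_pos hh0 _)]
    exact mul_le_mul_of_nonneg_left (hZ.abs_iterate_discreteLaplacian_le m h 0 _)
      (Real.rpow_nonneg hh0.le _))
  exact lt_of_lt_of_le (abs_pos.2 (mul_ne_zero hc hu)) hle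

theorem tendsto_rpow_mul_zero_of_abs_le {F : ℝ → ℝ} {ρ ρ₂ δ D : ℝ} (hδ : 0 < δ) (hρ : ρ₂ < ρ)
    (hF : ∀ h, 0 < h → h < δ → |F h| ≤ D * h ^ (-ρ₂)) :
    Tendsto (fun h : ℝ => h ^ ρ * F h) (𝓝[>] 0) (𝓝 0) := by
  have hpow : Tendsto (fun h : ℝ => D * h ^ (ρ - ρ₂)) (𝓝[>] 0) (𝓝 0) := by
    have := (Real.continuousAt_rpow_const 0 (ρ - ρ₂) (Or.inr (by linarith))).tendsto
    rw [Real.zero_rpow (by linarith)] at this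
    simpa using (this.mono_left nhdsWithin_le_nhds).const_mul D
  refine squeeze_zero_norm' ?_ hpow
  filter_upwards [Ioo_mem_nhdsGT hδ] with h hh
  rw [Real.norm_eq_abs, abs_mul, abs_of_pos (Real.rpow_pos_of_pos hh.1 _), sub_eq_add_neg,
    Real.rpow_add hh.1]
  calc h ^ ρ * |F h| ≤ h ^ ρ * (D * h ^ (-ρ₂)) :=
        mul_le_mul_of_nonneg_left (hF h hh.1 hh.2) (Real.rpow_nonneg hh.1.le _)
    _ = _ := by ring

/-- The ordinary least squares coefficient of the Laplacians is consistent. -/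
theorem tendstoInMeasure_lapEstimator (hd : 1 ≤ d) {L : ℝ} (hL : 0 < L) (m : ℕ)
    (Y : EuclideanSpace ℝ (Fin d) → Ω → ℝ) (β : ℝ) (α : Fin 2 → Fin 2 → ℝ)
    (hY : ∀ s ω, Y s ω = X s ω * β + W s ω) (hZ : IsStationaryGRF P X W C)
    (hC : IsIsotropicUpToRemainder C L α) (h01 : α 0 0 < α 0 1) (h11 : α 0 0 < α 1 1 + d)
    (h4m : α 0 0 < 4 * m) :
    TendstoInMeasure P (fun n ω => lapEstimator L m n (fun s => X s ω) (fun s => Y s ω))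
      atTop (fun _ => β) := by
  have hd0 : (0 : ℝ) < d := by exact_mod_cast hd
  obtain ⟨c, hc, hα, heven, hf00⟩ := hC.hasLocalExpansion hL 0 0 (2 * (2 * m))
  obtain ⟨_, -, hα01, -, hf01⟩ := hC.hasLocalExpansion hL 0 1 (2 * (2 * m))
  obtain ⟨_, -, hα11, -, hf11⟩ := hC.hasLocalExpansion hL 1 1 (2 * (2 * m))
  have hm : 1 ≤ m := by
    by_contra hcon
    have : m = 0 := by omega
    subst this
    simp at h4m
    linarith
  have hm2 : 1 ≤ 2 * m := by omega
  obtain ⟨δ₀, hδ₀, D₀, hD₀, hb₀⟩ := hf00.exists_abs_iterate_discreteLaplacian_le hm2 hα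
  obtain ⟨δ₁, hδ₁, D₁, hD₁, hb₁⟩ := hf11.exists_abs_iterate_discreteLaplacian_le hm2 hα11
  obtain ⟨δ₂, hδ₂, D₂, hD₂, hb₂⟩ := hf01.exists_abs_iterate_discreteLaplacian_le hm2 hα01
  have hcast : ∀ a : ℝ, (2 * ((2 * m : ℕ) : ℝ) - a) = 4 * m - a := fun a => by push_cast; ring
  rw [hcast] at hb₀ hb₁ hb₂
  set ρ := 4 * m - α 0 0 with hρ
  have hρ0 : 0 < ρ := by linarith
  rw [max_eq_left hρ0.le] at hb₀
  set ρ₁ := max (4 * m - α 1 1) 0 with hρ₁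
  set ρ₂ := max (4 * m - α 0 1) 0 with hρ₂
  have hρ₁0 : 0 ≤ ρ₁ := le_max_right _ _
  have hρ₂0 : 0 ≤ ρ₂ := le_max_right _ _
  -- `α 0 0 < α 1 1 + d` controls the variance of the cross sum. The next comparison rests on `α 0 0
  -- < α 0 1`, which makes its mean negligible and also bounds the second Isserlis term.
  have hρ₁ρ : ρ₁ < ρ + d := max_lt (by linarith) (by linarith)
  have hρ₂ρ : ρ₂ < ρ := max_lt (by linarith) hρ0
  set δ := min δ₀ (min δ₁ δ₂) with hδ
  have hδpos : 0 < δ := by positivity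
  set D := max D₀ (max D₁ D₂) with hD
  have hDpos : 0 ≤ D := hD₀.trans (le_max_left _ _)
  have hδ0 : δ ≤ δ₀ := min_le_left _ _
  have hδ1 : δ ≤ δ₁ := (min_le_right _ _).trans (min_le_left _ _)
  have hδ2 : δ ≤ δ₂ := (min_le_right _ _).trans (min_le_right _ _)
  have hD0 : D₀ ≤ D := le_max_left _ _
  have hD1 : D₁ ≤ D := (le_max_left _ _).trans (le_max_right _ _)
  have hD2 : D₂ ≤ D := (le_max_right _ _).trans (le_max_right _ _)
  have hB : ∀ {V : ℝ → EuclideanSpace ℝ (Fin d) → ℝ} {δ' D' r : ℝ}, δ ≤ δ' → D' ≤ D →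
      (∀ h u, 0 < h → h < δ' → ‖u‖ < δ' → |V h u| ≤ D' * (h + ‖u‖) ^ (-r)) →
      ∀ h u, 0 < h → h < δ → ‖u‖ < δ → |V h u| ≤ D * (h + ‖u‖) ^ (-r) := by
    intro V δ' D' r hδ' hD' hV h u hh hhδ huδ
    exact (hV h u hh (hhδ.trans_le hδ') (huδ.trans_le hδ')).trans
      (mul_le_mul_of_nonneg_right hD' (Real.rpow_nonneg (by positivity) _))
  replace hb₀ := hB (V := fun h u => (discreteLaplacian h)^[2 * m] (C 0 0) u) hδ0 hD0 hb₀
  replace hb₁ := hB (V := fun h u => (discreteLaplacian h)^[2 * m] (C 1 1) u) hδ1 hD1 hb₁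
  replace hb₂ := hB (V := fun h u => (discreteLaplacian h)^[2 * m] (C 0 1) u) hδ2 hD2 hb₂
  obtain ⟨κ, hκ, hκlim⟩ := hZ.exists_tendsto_variance_pos hd hα heven (hc rfl) h4m hf00
  have hDen := hZ.tendstoInMeasure_normalized_sum hL hm 0 hκlim
    -- For the denominator all three exponents equal ρ, and ρ < ρ + d suffices.
    (hZ.tendsto_variance_normalized_sum hd hL hm 0 rfl hρ0 hρ0.le hρ0.le hδpos hDpos
      (by linarith) le_rfl hb₀ hb₀ hb₀)
  have hNum := hZ.tendstoInMeasure_normalized_sum hL hm 1 (ρ := ρ) (κ := 0)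
    (tendsto_rpow_mul_zero_of_abs_le hδpos hρ₂ρ fun h hh hhδ => by
      have := hb₂ h 0 hh hhδ (by rwa [norm_zero])
      rwa [norm_zero, add_zero] at this)
    (hZ.tendsto_variance_normalized_sum hd hL hm 1 hC.cross_symm.symm hρ0 hρ₁0 hρ₂0 hδpos hDpos
      hρ₁ρ hρ₂ρ.le hb₀ hb₁ hb₂)
  have hlim := tendstoInMeasure_div_of_pos (β := β) hκ hDen hNum fun n ω => rfl
  refine hlim.congr' ?_ (Eventually.of_forall fun _ => rfl)
  filter_upwards [eventually_ge_atTop (2 * m)] with n hn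
  refine Eventually.of_forall fun ω => ?_
  have hn0 : (0 : ℝ) < n := by exact_mod_cast (by omega : 0 < n)
  have hcard : (0 : ℝ) < (gridInterior d n m).card := by
    exact_mod_cast card_gridInterior_pos hn
  have hfac : 0 < (L / n) ^ ρ / ((gridInterior d n m).card : ℝ) := by positivity
  have hYlap : ∀ s, (discreteLaplacian (L / n))^[m] (fun t => Y t ω) s =
      laplacianField X W m (L / n) 0 s ω * β + laplacianField X W m (L / n) 1 s ω := by
    intro s
    simp only [hY]
    rw [iterate_discreteLaplacian_add, iterate_discreteLaplacian_mul_const]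
    rfl
  have hXlap : ∀ s, (discreteLaplacian (L / n))^[m] (fun t => X t ω) s =
      laplacianField X W m (L / n) 0 s ω := fun s => rfl
  simp only [lapEstimator, hYlap, hXlap]
  rw [mul_assoc, ← mul_add, mul_div_mul_left _ _ hfac.ne', Finset.sum_mul, ← Finset.sum_add_distrib]
  congr 1
  · exact Finset.sum_congr rfl fun j _ => by ring
  · exact Finset.sum_congr rfl fun j _ => by ring

end Consistency

/-! ### From random fields to laws on the path space of the cube. -/

section PathSpace

variable {d : ℕ} {L : ℝ}

open Classical in
/-- Extension by zero of a function on the cube. -/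
noncomputable def extendByZero (p : cube d L → ℝ) (s : EuclideanSpace ℝ (Fin d)) : ℝ :=
  if hs : s ∈ cube d L then p ⟨s, hs⟩ else 0

theorem measurable_iterate_discreteLaplacian {S : Type*} [MeasurableSpace S]
    {z : S → EuclideanSpace ℝ (Fin d) → ℝ} (hz : ∀ s, Measurable fun p => z p s) (m : ℕ) (h : ℝ)
    (s : EuclideanSpace ℝ (Fin d)) : Measurable fun p => (discreteLaplacian h)^[m] (z p) s := by
  obtain ⟨N, w, v, -, hst⟩ := exists_stencil d m
  simp only [hst]
  exact (Finset.measurable_fun_sum _ fun i _ => (hz _).const_mul _).const_mul _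

theorem measurable_lapEstimator {S : Type*} [MeasurableSpace S]
    {z₁ z₂ : S → EuclideanSpace ℝ (Fin d) → ℝ} (hz₁ : ∀ s, Measurable fun p => z₁ p s)
    (hz₂ : ∀ s, Measurable fun p => z₂ p s) (m n : ℕ) :
    Measurable fun p => lapEstimator L m n (z₁ p) (z₂ p) := by
  simp only [lapEstimator]
  refine Measurable.div (Finset.measurable_fun_sum _ fun j _ => ?_)
    (Finset.measurable_fun_sum _ fun j _ => ?_)
  · exact (measurable_iterate_discreteLaplacian hz₁ m _ _).mul
      (measurable_iterate_discreteLaplacian hz₂ m _ _)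
  · exact (measurable_iterate_discreteLaplacian hz₁ m _ _).pow_const 2

theorem measurable_extendByZero_apply {φ : ℝ × ℝ → ℝ} (hφ : Measurable φ)
    (s : EuclideanSpace ℝ (Fin d)) :
    Measurable fun p : cube d L → ℝ × ℝ => extendByZero (fun t => φ (p t)) s := by
  unfold extendByZero
  split_ifs with hs
  · exact hφ.comp (measurable_pi_apply _)
  · exact measurable_const

/-- The estimator only involves values on the cube. -/
theorem lapEstimator_congr (hL : 0 < L) {m : ℕ} (hm : 1 ≤ m) (n : ℕ)
    {z₁ z₂ z₁' z₂' : EuclideanSpace ℝ (Fin d) → ℝ} (h₁ : ∀ s ∈ cube d L, z₁ s = z₁' s)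
    (h₂ : ∀ s ∈ cube d L, z₂ s = z₂' s) :
    lapEstimator L m n z₁ z₂ = lapEstimator L m n z₁' z₂' := by
  have key : ∀ {z z' : EuclideanSpace ℝ (Fin d) → ℝ}, (∀ s ∈ cube d L, z s = z' s) →
      ∀ j ∈ gridInterior d n m, (discreteLaplacian (L / n))^[m] z (gridPoint (L / n) j) =
        (discreteLaplacian (L / n))^[m] z' (gridPoint (L / n) j) := by
    intro z z' hz j hj
    refine iterate_discreteLaplacian_congr fun x hx => hz x fun g => ?_
    have hjg := mem_gridInterior.1 hj g
    -- The subtraction in n − m is truncated, but m ≥ 1 together with m ≤ j g ≤ n − m rules out n ≤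
    -- m.
    have hn : 0 < n := by omega
    have hn0 : (0 : ℝ) < n := by exact_mod_cast hn
    have hh : 0 < L / (n : ℝ) := div_pos hL hn0
    have h1 : (m : ℝ) ≤ j g := by exact_mod_cast hjg.1
    have h2 : (j g : ℝ) + m ≤ n := by
      have : j g + m ≤ n := by omega
      exact_mod_cast this
    have hxg := abs_le.1 (hx g)
    rw [abs_of_pos hh, show gridPoint (L / n) j g = L / n * (j g : ℝ) from rfl] at hxg
    have h3 := mul_le_mul_of_nonneg_left h1 hh.le
    have h4 := mul_le_mul_of_nonneg_left h2 hh.le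
    rw [div_mul_cancel₀ L hn0.ne'] at h4
    constructor <;> nlinarith
  simp only [lapEstimator]
  congr 1
  · exact Finset.sum_congr rfl fun j hj => by rw [key h₁ j hj, key h₂ j hj]
  · exact Finset.sum_congr rfl fun j hj => by rw [key h₁ j hj]

theorem extendByZero_of_mem {p : cube d L → ℝ} {s : EuclideanSpace ℝ (Fin d)}
    (hs : s ∈ cube d L) : extendByZero p s = p ⟨s, hs⟩ := by
  rw [extendByZero, dif_pos hs]

/-- The deviation events of T n are measurable, so their probabilities under the image law are those
of their preimages. -/
theorem TendstoInMeasure.map_of_comp {Ω S : Type*} [MeasurableSpace Ω] [MeasurableSpace S]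
    {P : Measure Ω} {φ : Ω → S} (hφ : Measurable φ) {T : ℕ → S → ℝ} (hT : ∀ n, Measurable (T n))
    {c : ℝ} (h : TendstoInMeasure P (fun n ω => T n (φ ω)) atTop (fun _ => c)) :
    TendstoInMeasure (P.map φ) T atTop (fun _ => c) := by
  intro ε hε
  refine (h ε hε).congr fun n => ?_
  rw [Measure.map_apply hφ (measurableSet_le measurable_const ((hT n).edist measurable_const))]
  rfl

/-- The estimator applied to the path extended by zero depends on neither β nor the law. It is
measurable because it uses finitely many values of the path, and the extension is immaterial since
the stencils stay inside the cube. -/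
theorem consistentlyEstimable_slopeModels (hd : 1 ≤ d) (hL : 0 < L) (m : ℕ) :
    ConsistentlyEstimable (slopeModels d L m) := by
  set T : ℕ → (cube d L → ℝ × ℝ) → ℝ := fun n p =>
    lapEstimator L m n (extendByZero fun t => (p t).1) (extendByZero fun t => (p t).2) with hT
  have hTm : ∀ n, Measurable (T n) := fun n =>
    measurable_lapEstimator (measurable_extendByZero_apply measurable_fst)
      (measurable_extendByZero_apply measurable_snd) m n
  refine ⟨T, hTm, ?_⟩
  rintro ⟨β, ν⟩ ⟨Ω, _, P, X, W, C, α, hP, hZ, hC, h01, h11, h4m, hν⟩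
  simp only at hν
  subst hν
  have hm : 1 ≤ m := by
    by_contra hcon
    obtain ⟨-, -, hα, -⟩ := hC.hasLocalExpansion hL 0 0 0
    have : m = 0 := by omega
    subst this
    simp at h4m
    linarith
  have hX : ∀ s, Measurable (X s) := fun s => hZ.measurable 0 s
  have hW : ∀ s, Measurable (W s) := fun s => hZ.measurable 1 s
  have hφ : Measurable fun ω (s : cube d L) => (X s ω, X s ω * β + W s ω) :=
    measurable_pi_lambda _ fun s => (hX s).prodMk (((hX s).mul_const β).add (hW s))
  refine TendstoInMeasure.map_of_comp hφ hTm ?_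
  have hlim := tendstoInMeasure_lapEstimator hd hL m (fun s ω => X s ω * β + W s ω) β α
    (fun _ _ => rfl) hZ hC h01 h11 h4m
  refine hlim.congr_left fun n => Eventually.of_forall fun ω => ?_
  exact lapEstimator_congr hL hm n (fun s hs => by rw [extendByZero_of_mem hs])
    (fun s hs => by rw [extendByZero_of_mem hs])

end PathSpace

theorem theorem3 {d : ℕ} (hd : 1 ≤ d) {L : ℝ} (hL : 0 < L) (m : ℕ) :
    ConsistentlyEstimable (slopeModels d L m) ∧
    ∀ {Ω : Type*} [MeasurableSpace Ω] (P : Measure Ω) [IsProbabilityMeasure P]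
      (X W Y : EuclideanSpace ℝ (Fin d) → Ω → ℝ) (β : ℝ)
      (C : Fin 2 → Fin 2 → EuclideanSpace ℝ (Fin d) → ℝ) (α : Fin 2 → Fin 2 → ℝ),
      (∀ s ω, Y s ω = X s ω * β + W s ω) →
      IsStationaryGRF P X W C → IsIsotropicUpToRemainder C L α →
      α 0 0 < α 0 1 → α 0 0 < α 1 1 + d → α 0 0 < 4 * m →
      TendstoInMeasure P (fun n ω => lapEstimator L m n (fun s => X s ω) (fun s => Y s ω))
        atTop (fun _ => β) :=
  ⟨consistentlyEstimable_slopeModels hd hL m,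
    fun _ _ _ _ _ _ _ _ hY hZ hC h01 h11 h4m =>
      tendstoInMeasure_lapEstimator hd hL m _ _ _ hY hZ hC h01 h11 h4m⟩
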